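/- Let $A$ be a set and let $\theta\subseteq A\times A$ be symmetric and antireflexive. For such a pair let $\mathbb M(A,\theta)=\langle A\mid ab=ba,\ (a,b)\in\theta\rangle_{\mathrm{mon}}$ and $\mathbb F(A,\theta)=\langle A\mid ab=ba,\ (a,b)\in\theta\rangle_{\mathrm{gr}}$ be the free partially commutative monoid and group. For $t\in\mathbb M(A,\theta)$ let $\mathrm{Alph}(t)$ be the set of letters occurring in $t$ and let $IA(t)=\{z\in A\mid t\in z\,\mathbb M(A,\theta)\}$. For $X\subseteq\mathbb M(A,\theta)$ put $\theta_X=\{(x_1,x_2)\in X^2\mid \mathrm{Alph}(x_1)\times\mathrm{Alph}(x_2)\subseteq\theta\}$. Call $X$ a *partially commutative code* if any two words over $X$ with the same product in $\mathbb M(A,\theta)$ are equal in $\mathbb M(X,\theta_X)$. For disjoint $B,Z\subseteq A$ put $\beta_Z(B)=\{zw\mid z\in Z,\ w\in\mathbb M(B,\theta_B),\ IA(zw)=\{z\}\}$, where $\theta_B=\theta\cap B^2$. Call $B$ a *transitively factorizing subalphabet* (TFSA) of $A$ if $\beta_{A\setminus B}(B)$ is a partially commutative code. Let $\overline A=\{\bar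 a\mid a\in A\}$ be a disjoint copy of $A$ and $\tilde A=A\cup\overline A$. Let $\tilde\theta$ be the relation on $\tilde A$ under which two letters commute iff the underlying letters of $A$ are related by $\theta$. For $B\subseteq A$ put $\tilde B=B\cup\overline B$. Let $s:\mathbb M(\tilde A,\tilde\theta)\to\mathbb F(A,\theta)$ be the morphism with $a\mapsto a$, $\bar a\mapsto a^{-1}$. A trace is *reduced* if it has minimal length among the traces with the same image under $s$. Let $(B,Z)$ be a partition of $A$ (either part may be empty). Let $\beta_Z^R(\tilde B)$ be the set of reduced traces in $\beta_Z(\tilde B)\subseteq\mathbb M(\tilde A,\tilde\theta)$, with commutation relation $\tilde\theta_{\beta_Z^R(\tilde B)}$. Let $H_Z$ be the normal subgroup of $\mathbb F(A,\theta)$ generated by $Z$, and let $$\rho_Z(B)=\{s(w)^{-1}\,z\,s(w)\mid z\in Z,\ w\in\mathbb M(\tilde B,\tilde\theta_{\tilde B}),\ zw\in\beta_Z^R(\tilde B)\}\subseteq\mathbb F(A,\theta).$$ (i) The natural map $\mathbb F(B,\theta_B)\to\mathbb F(A,\theta)$ is injective, $\mathbb F(A,\theta)=\mathbb F(B,\theta_B)\ltimes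 H_Z$ is an internal semidirect product, and $H_Z$ is the subgroup generated by $\rho_Z(B)$. (ii) $H_Z$ is free partially commutative on $\rho_Z(B)$ with the commutations $\hat\theta_\rho=\{(t,t')\in\rho_Z(B)^2\mid tt'=t't,\ t\ne t'\}$: there is an isomorphism $\mathbb F(\rho_Z(B),\hat\theta_\rho)\to H_Z$ that sends each generator $t$ to $t$. (iii) There is a unique homomorphism $\alpha:\mathbb F(\beta_Z^R(\tilde B),\tilde\theta_{\beta_Z^R(\tilde B)})\to H_Z$ with $\alpha(zw)=s(w)^{-1}\,z\,s(w)$ for every generator $zw\in\beta_Z^R(\tilde B)$ ($z\in Z$, $w\in\mathbb M(\tilde B,\tilde\theta_{\tilde B})$), and $\alpha$ is injective if and only if $B$ is a TFSA of $A$. -/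

import Mathlib

namespace PartComm

/-- The commutation relators `ab = ba`, `(a,b) ∈ θ`, on words. -/
inductive CommRel {A : Type*} (θ : A → A → Prop) : FreeMonoid A → FreeMonoid A → Prop
  | swap (a b : A) (h : θ a b) :
      CommRel θ (FreeMonoid.of a * FreeMonoid.of b) (FreeMonoid.of b * FreeMonoid.of a)

/-- The free partially commutative monoid `M(A,θ) = ⟨A | ab = ba, (a,b) ∈ θ⟩`. Its elements are
called traces. -/
abbrev FPCMonoid {A : Type*} (θ : A → A → Prop) : Type _ := PresentedMonoid (CommRel θ)

/-- The commutation relators `ab(ba)⁻¹`, `(a,b) ∈ θ`, in the free group. -/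
def groupRels {A : Type*} (θ : A → A → Prop) : Set (FreeGroup A) :=
  {g | ∃ a b : A, θ a b ∧
    g = FreeGroup.of a * FreeGroup.of b * (FreeGroup.of b * FreeGroup.of a)⁻¹}

/-- The free partially commutative group `F(A,θ) = ⟨A | ab = ba, (a,b) ∈ θ⟩`. -/
abbrev FPCGroup {A : Type*} (θ : A → A → Prop) : Type _ := PresentedGroup (groupRels θ)

section Monoid

variable {A : Type*} {θ : A → A → Prop}

/-- The letter `a` as a trace. -/
abbrev mlet (θ : A → A → Prop) (a : A) : FPCMonoid θ := PresentedMonoid.of (CommRel θ) a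

/-- Universal property of `M(A,θ)`. -/
def mlift {M : Type*} [Monoid M] (f : A → M) (h : ∀ a b, θ a b → f a * f b = f b * f a) :
    FPCMonoid θ →* M :=
  PresentedMonoid.lift f (by
    rintro _ _ ⟨a, b, hab⟩
    simpa using h a b hab)

/-- The multiset of the letters of a trace, counted with multiplicity. -/
def content : FPCMonoid θ →* Multiplicative (Multiset A) :=
  mlift (fun a => Multiplicative.ofAdd {a}) (fun _ _ _ => mul_comm _ _)

/-- `Alph(t)`: the set of the letters that occur in the trace `t`. -/
def alph (t : FPCMonoid θ) : Set A := {a | a ∈ (content t).toAdd}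

/-- The length of a trace. -/
def length (t : FPCMonoid θ) : ℕ := Multiset.card (content t).toAdd

/-- `IA(t) = {z ∈ A | ∃ w, t = zw}`: the initial alphabet of the trace `t`. -/
def initialAlph (t : FPCMonoid θ) : Set A := {z | ∃ w : FPCMonoid θ, t = mlet θ z * w}

/-- `θ_X = {(x₁,x₂) ∈ X² | Alph(x₁) × Alph(x₂) ⊆ θ}` for a set `X` of traces. -/
def traceRel (X : Set (FPCMonoid θ)) (x₁ x₂ : X) : Prop :=
  ∀ a ∈ alph x₁.1, ∀ b ∈ alph x₂.1, θ a b

/-- `X` is a partially commutative code: every trace in the submonoid `⟨X⟩` has a decomposition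
over `X` that is unique up to the commutations of `θ_X`. That is, two words over `X` with the same
product in `M(A,θ)` represent the same element of `M(X,θ_X)`. -/
def IsPCCode (X : Set (FPCMonoid θ)) : Prop :=
  ∀ u v : FreeMonoid X,
    FreeMonoid.lift (fun x : X => (x : FPCMonoid θ)) u =
      FreeMonoid.lift (fun x : X => (x : FPCMonoid θ)) v →
    PresentedMonoid.mk (CommRel (traceRel X)) u = PresentedMonoid.mk (CommRel (traceRel X)) v

/-- `M(B,θ_B)`, as the submonoid of `M(A,θ)` generated by the letters of `B`. -/
def subTraces (θ : A → A → Prop) (B : Set A) : Submonoid (FPCMonoid θ) :=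
  Submonoid.closure (mlet θ '' B)

/-- `β_Z(B) = {zw | z ∈ Z, w ∈ M(B,θ_B), IA(zw) = {z}}`. -/
def beta (θ : A → A → Prop) (B Z : Set A) : Set (FPCMonoid θ) :=
  {t | ∃ z ∈ Z, ∃ w ∈ subTraces θ B, t = mlet θ z * w ∧ initialAlph t = {z}}

/-- `B ⊆ A` is a transitively factorizing subalphabet: with `Z = A - B`, the set `β_Z(B)` is a
partially commutative code. -/
def IsTFSA (θ : A → A → Prop) (B : Set A) : Prop := IsPCCode (beta θ B Bᶜ)

end Monoid

section Group

variable {A : Type*} {θ : A → A → Prop}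

/-- The generator `a` of `F(A,θ)`. -/
abbrev glet (θ : A → A → Prop) (a : A) : FPCGroup θ := PresentedGroup.of a

/-- Universal property of `F(A,θ)`. -/
def glift {G : Type*} [Group G] (f : A → G) (h : ∀ a b, θ a b → f a * f b = f b * f a) :
    FPCGroup θ →* G :=
  PresentedGroup.toGroup (f := f) (by
    rintro _ ⟨a, b, hab, rfl⟩
    simp only [map_mul, map_inv, FreeGroup.lift_apply_of]
    rw [h a b hab, mul_inv_cancel])

theorem glet_comm {a b : A} (h : θ a b) : glet θ a * glet θ b = glet θ b * glet θ a := by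
  have : PresentedGroup.mk (groupRels θ)
      (FreeGroup.of a * FreeGroup.of b * (FreeGroup.of b * FreeGroup.of a)⁻¹) = 1 :=
    PresentedGroup.one_of_mem ⟨a, b, h, rfl⟩
  rw [map_mul, map_inv, mul_inv_eq_one, map_mul, map_mul] at this
  exact this

/-- `θ_B`: the restriction of `θ` to `B`. -/
def restrictRel (θ : A → A → Prop) (B : Set A) (a b : B) : Prop := θ a b

/-- The natural homomorphism `F(B,θ_B) → F(A,θ)`. -/
def subgroupMap (θ : A → A → Prop) (B : Set A) : FPCGroup (restrictRel θ B) →* FPCGroup θ :=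
  glift (fun b => glet θ b) (fun _ _ h => glet_comm h)

/-- The letter of `A` underlying a letter of `Ã = A ∪ Ā`; here `Ã` is `A ⊕ A`, with `a` as
`Sum.inl a` and `ā` as `Sum.inr a`. -/
def base (x : A ⊕ A) : A := Sum.elim id id x

/-- The independence relation `θ̃` on `Ã`: two letters commute when the underlying letters do. -/
def extRel (θ : A → A → Prop) (x y : A ⊕ A) : Prop := θ (base x) (base y)

/-- `B̃ = B ∪ B̄ ⊆ Ã`. -/
def extSet (B : Set A) : Set (A ⊕ A) := {x | base x ∈ B}

/-- `s₀ : Ã → F(A,θ)`, `a ↦ a`, `ā ↦ a⁻¹`. -/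
def sZero (θ : A → A → Prop) : A ⊕ A → FPCGroup θ
  | Sum.inl a => glet θ a
  | Sum.inr a => (glet θ a)⁻¹

theorem sZero_comm {x y : A ⊕ A} (h : extRel θ x y) :
    sZero θ x * sZero θ y = sZero θ y * sZero θ x := by
  have key : ∀ a b, θ a b → Commute (glet θ a) (glet θ b) := fun a b h => glet_comm h
  rcases x with a | a <;> rcases y with b | b
  · exact key a b h
  · exact (key a b h).inv_right
  · exact (key a b h).inv_left
  · exact (key a b h).inv_inv

/-- The homomorphism `s : M(Ã,θ̃) → F(A,θ)` that extends `s₀`. -/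
def sMap (θ : A → A → Prop) : FPCMonoid (extRel θ) →* FPCGroup θ :=
  mlift (sZero θ) (fun _ _ h => sZero_comm h)

/-- `red(Ã,θ̃)`: the traces of minimal length among those with the same image under `s`. -/
def reduced (θ : A → A → Prop) : Set (FPCMonoid (extRel θ)) :=
  {t | ∀ t', sMap θ t' = sMap θ t → length t ≤ length t'}

/-- `β_Z^R(B̃) = β_Z(B̃) ∩ red(Ã,θ̃)`, with `Z ⊆ A ⊆ Ã`. -/
def betaR (θ : A → A → Prop) (B Z : Set A) : Set (FPCMonoid (extRel θ)) :=
  beta (extRel θ) (extSet B) (Sum.inl '' Z) ∩ reduced θ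

/-- `ρ_Z(B) = {w⁻¹zw | zw ∈ β_Z^R(B̃)}`. -/
def rho (θ : A → A → Prop) (B Z : Set A) : Set (FPCGroup θ) :=
  {g | ∃ z ∈ Z, ∃ w ∈ subTraces (extRel θ) (extSet B),
    mlet (extRel θ) (Sum.inl z) * w ∈ betaR θ B Z ∧
      g = (sMap θ w)⁻¹ * glet θ z * sMap θ w}

/-- `θ̂_ρ = {(t,t') ∈ ρ_Z(B)² | tt' = t't and t ≠ t'}`. -/
def rhoRel (θ : A → A → Prop) (B Z : Set A) (t t' : rho θ B Z) : Prop :=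
  (t : FPCGroup θ) * t' = t' * t ∧ t ≠ t'

/-- `H_Z`: the normal subgroup of `F(A,θ)` generated by `Z`. -/
def HZ (θ : A → A → Prop) (Z : Set A) : Subgroup (FPCGroup θ) :=
  Subgroup.normalClosure (glet θ '' Z)

/-- `α : F(β_Z^R(B̃), θ̃_{β_Z^R(B̃)}) → H_Z` is the natural map: `α(zw) = w⁻¹zw` on generators. -/
def IsNatural (θ : A → A → Prop) (B Z : Set A)
    (α : FPCGroup (traceRel (betaR θ B Z)) →* HZ θ Z) : Prop :=
  ∀ x : betaR θ B Z, ∀ z ∈ Z, ∀ w ∈ subTraces (extRel θ) (extSet B),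
    (x : FPCMonoid (extRel θ)) = mlet (extRel θ) (Sum.inl z) * w →
      (α (glet (traceRel (betaR θ B Z)) x) : FPCGroup θ) =
        (sMap θ w)⁻¹ * glet θ z * sMap θ w

end Group

end PartComm

namespace PartComm

/-! For `z` in `Z` let `S_z` be the subgroup of `F(B,θ_B)` generated by the letters that commute
with `z`. The conjugate `g z g⁻¹` depends only on `z` and the coset `g S_z`, and two such conjugates
commute when their letters are related and their cosets meet. Let `K` be the free partially
commutative group on these pairs (`Vert`, `vertRel`). The group `F(B,θ_B)` permutes the pairs, and
`toSemidirect` and `fromSemidirect` identify `F(A,θ)` with `K ⋊ F(B,θ_B)`. So `F(B,θ_B)` embeds, and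
`H_Z` is both the kernel of the retraction and an isomorphic image of `K` (`HZ_eq_ker`,
`vertHom_injective`). Distinct generators commute only if they are related (`rel_of_commute`), hence
the relation on pairs is exactly commutation of distinct conjugates (`vertRel_iff`). Shortest
representatives show that all these conjugates lie in `ρ_Z(B)` (`rho_eq_range`); this gives (i) and
(ii).

For (iii), a trace `zw` in `β_Z^R(B̃)` is recovered from `z` and the coset of `s(w)`
(`betaVert_injective`), because `F(A,θ)` acts on the traces without cancelling factor. So `α` never
identifies generators, and only the relations matter: it must not make unrelated generators commute.
This and the TFSA property are both equivalent to the graph condition `Separated`. If it holds,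
related letters of `Z` force all letters of the two traces to commute (`Separated.forall_rel`), so
the two relations agree, and factors over the code can be peeled off one by one. If it fails for `z`
and `z'`, a shortest path yields `w` and `c` such that `z'` commutes with `z` and `w` but not with
`c`. Then `z' · zwc = zw · z'c` violates the code property, and `zwc`, `z'c` are unrelated
generators whose images under `α` commute. -/

/-- The commutation relations of traces: irreflexive and symmetric. -/
structure IsIndependence {A : Type*} (θ : A → A → Prop) : Prop where
  irrefl : ∀ a, ¬ θ a a
  symm : ∀ a b, θ a b → θ b a

/-! ### Traces: left quotients, cancellation and initial letters. -/

section Traces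

variable {A : Type*} {θ : A → A → Prop}

@[simp]
theorem mlift_mlet {M : Type*} [Monoid M] (f : A → M) (h : ∀ a b, θ a b → f a * f b = f b * f a)
    (a : A) : mlift f h (mlet θ a) = f a := by
  simp [mlift, mlet]

theorem mlet_comm {a b : A} (h : θ a b) : mlet θ a * mlet θ b = mlet θ b * mlet θ a :=
  PresentedMonoid.mk_eq_mk_iff.2 (ConGen.Rel.of _ _ (CommRel.swap a b h))

theorem mlet_left_comm {a b : A} (h : θ a b) (t : FPCMonoid θ) :
    mlet θ a * (mlet θ b * t) = mlet θ b * (mlet θ a * t) := by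
  rw [← mul_assoc, mlet_comm h, mul_assoc]

theorem closure_range_mlet : Submonoid.closure (Set.range (mlet θ)) = ⊤ :=
  PresentedMonoid.closure_range_of _

theorem trace_induction {p : FPCMonoid θ → Prop} (one : p 1)
    (mul : ∀ a t, p t → p (mlet θ a * t)) (t : FPCMonoid θ) : p t := by
  refine Submonoid.closure_induction_left (s := Set.range (mlet θ))
    (motive := fun x _ => p x) one ?_ (closure_range_mlet (θ := θ) ▸ Submonoid.mem_top t)
  rintro _ ⟨a, rfl⟩ y _ hy
  exact mul a y hy

theorem trace_induction_right {p : FPCMonoid θ → Prop} (one : p 1)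
    (mul : ∀ t a, p t → p (t * mlet θ a)) (t : FPCMonoid θ) : p t := by
  refine Submonoid.closure_induction_right (s := Set.range (mlet θ))
    (motive := fun x _ => p x) one ?_ (closure_range_mlet (θ := θ) ▸ Submonoid.mem_top t)
  rintro y _ _ ⟨a, rfl⟩ hy
  exact mul y a hy

@[simp] theorem content_mlet (a : A) : content (mlet θ a) = Multiplicative.ofAdd {a} :=
  mlift_mlet _ _ a

@[simp] theorem alph_one : alph (1 : FPCMonoid θ) = ∅ := by
  ext; simp [alph]

@[simp] theorem alph_mlet (a : A) : alph (mlet θ a) = {a} := by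
  ext; simp [alph]

@[simp] theorem alph_mul (s t : FPCMonoid θ) : alph (s * t) = alph s ∪ alph t := by
  ext; simp [alph]

@[simp] theorem length_one : length (1 : FPCMonoid θ) = 0 := by simp [length]

@[simp] theorem length_mlet (a : A) : length (mlet θ a) = 1 := by simp [length]

@[simp] theorem length_mul (s t : FPCMonoid θ) : length (s * t) = length s + length t := by
  simp [length]

theorem eq_one_or_eq_mlet_mul (t : FPCMonoid θ) : t = 1 ∨ ∃ a p, t = mlet θ a * p := by
  induction t using trace_induction with
  | one => exact Or.inl rfl
  | mul a t _ => exact Or.inr ⟨a, t, rfl⟩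

theorem mem_subTraces_iff {B : Set A} {t : FPCMonoid θ} : t ∈ subTraces θ B ↔ alph t ⊆ B := by
  constructor
  · intro h
    induction h using Submonoid.closure_induction with
    | mem x hx => obtain ⟨a, ha, rfl⟩ := hx; simpa using ha
    | one => simp
    | mul x y _ _ hx hy => simp [hx, hy]
  · induction t using trace_induction with
    | one => intro _; exact one_mem _
    | mul a t ih =>
      intro h
      simp only [alph_mul, alph_mlet, Set.union_subset_iff, Set.singleton_subset_iff] at h
      exact mul_mem (Submonoid.subset_closure ⟨a, h.1, rfl⟩) (ih h.2)

open Classical in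
/-- One letter of the computation of `t` together with its left quotient by the letter `a`. -/
noncomputable def leftQuotStep (θ : A → A → Prop) (a c : A) :
    Function.End (FPCMonoid θ × Option (FPCMonoid θ)) :=
  fun p => (mlet θ c * p.1,
    if c = a then some p.1 else if θ a c then p.2.map (mlet θ c * ·) else none)

/-- This makes the quotient well defined on traces and not only on words. Irreflexivity gives `c ≠
d`, so at most one of the two letters is the one divided out. The trace itself is carried along
because the quotient of `a t` by `a` is `t`. -/
theorem leftQuotStep_comm (hθ : IsIndependence θ) (a c d : A) (h : θ c d) :
    leftQuotStep θ a c * leftQuotStep θ a d = leftQuotStep θ a d * leftQuotStep θ a c := by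
  have hcd : c ≠ d := by rintro rfl; exact hθ.irrefl _ h
  funext ⟨t, o⟩
  change leftQuotStep θ a c (leftQuotStep θ a d (t, o)) =
    leftQuotStep θ a d (leftQuotStep θ a c (t, o))
  simp only [leftQuotStep, mlet_left_comm h, Prod.mk.injEq, true_and]
  by_cases hc : c = a
  · subst hc
    simp [hcd.symm, h]
  by_cases hd : d = a
  · subst hd
    simp [hc, hθ.symm _ _ h]
  by_cases h1 : θ a c <;> by_cases h2 : θ a d <;> cases o <;> simp [hc, hd, h1, h2, mlet_left_comm h]

/-- The left quotient of `t` by the letter `a`, if there is one. -/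
noncomputable def leftQuot (hθ : IsIndependence θ) (a : A) (t : FPCMonoid θ) :
    Option (FPCMonoid θ) :=
  (mlift (leftQuotStep θ a) (leftQuotStep_comm hθ a) t (1, none)).2

theorem mlift_leftQuotStep_fst (hθ : IsIndependence θ) (a : A) (t : FPCMonoid θ) :
    (mlift (leftQuotStep θ a) (leftQuotStep_comm hθ a) t (1, none)).1 = t := by
  induction t using trace_induction with
  | one => simp; rfl
  | mul c t ih =>
    rw [map_mul, mlift_mlet]
    change mlet θ c * _ = _
    rw [ih]

open Classical in
theorem leftQuot_mlet_mul (hθ : IsIndependence θ) (a c : A) (t : FPCMonoid θ) :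
    leftQuot hθ a (mlet θ c * t) =
      if c = a then some t else if θ a c then (leftQuot hθ a t).map (mlet θ c * ·) else none := by
  rw [leftQuot, map_mul, mlift_mlet]
  change (leftQuotStep θ a c (mlift (leftQuotStep θ a) _ t (1, none))).2 = _
  rw [leftQuotStep, mlift_leftQuotStep_fst hθ, leftQuot]

theorem leftQuot_self (hθ : IsIndependence θ) (a : A) (t : FPCMonoid θ) :
    leftQuot hθ a (mlet θ a * t) = some t := by
  simp [leftQuot_mlet_mul]

theorem eq_of_leftQuot (hθ : IsIndependence θ) {a : A} {t p : FPCMonoid θ}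
    (h : leftQuot hθ a t = some p) : t = mlet θ a * p := by
  induction t using trace_induction generalizing p with
  | one =>
    rw [leftQuot, map_one] at h
    exact absurd h (Option.some_ne_none p).symm
  | mul c t ih =>
    rw [leftQuot_mlet_mul] at h
    split_ifs at h with h1 h2
    · cases h; rw [h1]
    · rw [Option.map_eq_some_iff] at h
      obtain ⟨q, hq, rfl⟩ := h
      rw [ih hq, mlet_left_comm h2]

theorem mlet_mul_cancel (hθ : IsIndependence θ) {a : A} {s t : FPCMonoid θ}
    (h : mlet θ a * s = mlet θ a * t) : s = t := by
  have := leftQuot_self hθ a s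
  rw [h, leftQuot_self] at this
  exact (Option.some.inj this).symm

/-- Levi's lemma for two letters. -/
theorem levi (hθ : IsIndependence θ) {a b : A} {s t : FPCMonoid θ} (hab : a ≠ b)
    (h : mlet θ a * s = mlet θ b * t) :
    θ a b ∧ ∃ p, s = mlet θ b * p ∧ t = mlet θ a * p := by
  have := leftQuot_self hθ a s
  rw [h, leftQuot_mlet_mul, if_neg hab.symm] at this
  split_ifs at this with h1
  rw [Option.map_eq_some_iff] at this
  obtain ⟨p, hp, rfl⟩ := this
  exact ⟨h1, p, rfl, eq_of_leftQuot hθ hp⟩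

theorem mem_initialAlph_mlet_mul (hθ : IsIndependence θ) {a c : A} {t : FPCMonoid θ} :
    a ∈ initialAlph (mlet θ c * t) ↔ a = c ∨ θ a c ∧ a ∈ initialAlph t := by
  constructor
  · rintro ⟨w, hw⟩
    by_cases hac : a = c
    · exact Or.inl hac
    · obtain ⟨h, p, _, hp⟩ := levi hθ hac hw.symm
      exact Or.inr ⟨h, p, hp⟩
  · rintro (rfl | ⟨h, p, rfl⟩)
    · exact ⟨t, rfl⟩
    · exact ⟨mlet θ c * p, mlet_left_comm (hθ.symm _ _ h) p⟩

@[simp] theorem initialAlph_one : initialAlph (1 : FPCMonoid θ) = ∅ := by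
  ext a
  simp only [Set.mem_empty_iff_false, iff_false]
  rintro ⟨w, hw⟩
  have := congrArg length hw
  simp only [length_one, length_mul, length_mlet] at this
  omega

/-- A letter that starts the product but not `s` comes from `t` and has to slide past all of `s`. -/
theorem mem_initialAlph_mul (hθ : IsIndependence θ) {a : A} {s t : FPCMonoid θ} :
    a ∈ initialAlph (s * t) ↔
      a ∈ initialAlph s ∨ (∀ c ∈ alph s, θ a c) ∧ a ∈ initialAlph t := by
  induction s using trace_induction with
  | one => simp
  | mul c s ih =>
    rw [mul_assoc, mem_initialAlph_mlet_mul hθ, mem_initialAlph_mlet_mul hθ, ih]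
    simp only [alph_mul, alph_mlet, Set.mem_union, Set.mem_singleton_iff, forall_eq_or_imp]
    tauto

theorem initialAlph_mlet (hθ : IsIndependence θ) (a : A) : initialAlph (mlet θ a) = {a} := by
  ext c
  have := mem_initialAlph_mlet_mul hθ (a := c) (c := a) (t := 1)
  simpa using this

theorem commute_map_of_alph {M : Type*} [Monoid M] (f : FPCMonoid θ →* M) {s t : FPCMonoid θ}
    (h : ∀ a ∈ alph s, ∀ b ∈ alph t, Commute (f (mlet θ a)) (f (mlet θ b))) :
    Commute (f s) (f t) := by
  induction s using trace_induction with
  | one => simp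
  | mul a s ih =>
    simp only [alph_mul, alph_mlet, Set.mem_union, Set.mem_singleton_iff] at h
    rw [map_mul]
    refine Commute.mul_left ?_ (ih fun c hc => h c (Or.inr hc))
    replace h := h a (Or.inl rfl)
    clear ih
    induction t using trace_induction with
    | one => simp
    | mul b t ih =>
      simp only [alph_mul, alph_mlet, Set.mem_union, Set.mem_singleton_iff] at h
      rw [map_mul]
      exact (h b (Or.inl rfl)).mul_right (ih fun c hc => h c (Or.inr hc))

theorem commute_of_alph {s t : FPCMonoid θ} (h : ∀ a ∈ alph s, ∀ b ∈ alph t, θ a b) :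
    Commute s t :=
  commute_map_of_alph (MonoidHom.id _) fun a ha b hb => mlet_comm (h a ha b hb)

end Traces

end PartComm

namespace PartComm

/-! ### Free partially commutative groups: commuting generators and induced maps. -/

section Groups

variable {X Y : Type*} {ξ : X → X → Prop} {υ : Y → Y → Prop}

@[simp]
theorem glift_glet {G : Type*} [Group G] (f : X → G) (h : ∀ a b, ξ a b → f a * f b = f b * f a)
    (a : X) : glift f h (glet ξ a) = f a :=
  PresentedGroup.toGroup.of _

theorem closure_range_glet : Subgroup.closure (Set.range (glet ξ)) = ⊤ :=
  PresentedGroup.closure_range_of _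

theorem fpcGroup_hom_ext {G : Type*} [Group G] {f g : FPCGroup ξ →* G}
    (h : ∀ a, f (glet ξ a) = g (glet ξ a)) : f = g :=
  PresentedGroup.ext h

open Classical in
/-- Every map that sends one generator to `p`, another to `q` and the rest to `1` extends to a
homomorphism if the two generators are not related. -/
noncomputable def pairHom {G : Type*} [Group G] (p q : G) {x y : X} (hxy : ¬ ξ x y)
    (hyx : ¬ ξ y x) : FPCGroup ξ →* G :=
  glift (fun a => if a = x then p else if a = y then q else 1) (by
    intro a b h
    split_ifs <;> simp_all)

theorem pairHom_left {G : Type*} [Group G] (p q : G) {x y : X} (hxy : ¬ ξ x y)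
    (hyx : ¬ ξ y x) : pairHom p q hxy hyx (glet ξ x) = p := by
  simp [pairHom]

theorem pairHom_right {G : Type*} [Group G] (p q : G) {x y : X} (hxy : ¬ ξ x y)
    (hyx : ¬ ξ y x) (hne : y ≠ x) : pairHom p q hxy hyx (glet ξ y) = q := by
  simp [pairHom, hne]

/-- Generators of a free partially commutative group commute only if they are equal or related. -/
theorem rel_of_commute (hξ : IsIndependence ξ) {x y : X} (hne : x ≠ y)
    (h : Commute (glet ξ x) (glet ξ y)) : ξ x y := by
  by_contra hxy
  have hyx : ¬ ξ y x := fun h' => hxy (hξ.symm _ _ h')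
  -- Unrelated generators can be sent to the two free generators of a free group, which do not
  -- commute: their two products have different reduced words.
  have := h.map (pairHom (FreeGroup.of true) (FreeGroup.of false) hxy hyx)
  rw [pairHom_left, pairHom_right _ _ _ _ hne.symm] at this
  have := congrArg FreeGroup.toWord this.eq
  revert this
  decide

theorem glet_injective : Function.Injective (glet ξ) := by
  classical
  intro x y h
  by_contra hne
  let f : FPCGroup ξ →* Multiplicative ℤ :=
    glift (fun a => if a = x then Multiplicative.ofAdd 1 else 1) (fun _ _ _ => mul_comm _ _)
  have := congrArg f h
  simp [f, Ne.symm hne] at this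

/-- The homomorphism of free partially commutative groups induced by a map of generators. -/
def gmap (f : X → Y) (h : ∀ a b, ξ a b → υ (f a) (f b)) : FPCGroup ξ →* FPCGroup υ :=
  glift (fun a => glet υ (f a)) (fun _ _ hab => glet_comm (h _ _ hab))

@[simp]
theorem gmap_glet (f : X → Y) (h : ∀ a b, ξ a b → υ (f a) (f b)) (a : X) :
    gmap f h (glet ξ a) = glet υ (f a) :=
  glift_glet _ _ a

/-- Since the relation is reflected too, killing the generators outside the image gives a left
inverse. -/
theorem gmap_injective (f : X → Y) (hf : Function.Injective f)
    (h : ∀ a b, ξ a b ↔ υ (f a) (f b)) :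
    Function.Injective (gmap f fun a b => (h a b).1) := by
  classical
  let r : FPCGroup υ →* FPCGroup ξ :=
    glift (fun y => if hy : ∃ x, f x = y then glet ξ hy.choose else 1) (by
      intro a b hab
      by_cases ha : ∃ x, f x = a
      · by_cases hb : ∃ x, f x = b
        · simp only [ha, hb, dif_pos]
          apply glet_comm
          rw [h, ha.choose_spec, hb.choose_spec]
          exact hab
        · simp [hb]
      · simp [ha])
  have hr : r.comp (gmap f fun a b => (h a b).1) = MonoidHom.id _ := by
    apply fpcGroup_hom_ext
    intro a
    have ha : ∃ x, f x = f a := ⟨a, rfl⟩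
    simp only [r, MonoidHom.comp_apply, gmap_glet, glift_glet, ha, dif_pos, MonoidHom.id_apply]
    rw [hf ha.choose_spec]
  exact Function.LeftInverse.injective (g := r) fun x => DFunLike.congr_fun hr x

/-- The isomorphism of free partially commutative groups induced by a bijection of generators. -/
def gequiv (f : X ≃ Y) (h : ∀ a b, ξ a b ↔ υ (f a) (f b)) : FPCGroup ξ ≃* FPCGroup υ :=
  MonoidHom.toMulEquiv (gmap f fun a b => (h a b).1)
    (gmap f.symm fun a b hab => (h _ _).2 (by simpa using hab))
    (fpcGroup_hom_ext fun a => by simp) (fpcGroup_hom_ext fun a => by simp)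

@[simp]
theorem gequiv_glet (f : X ≃ Y) (h : ∀ a b, ξ a b ↔ υ (f a) (f b)) (a : X) :
    gequiv f h (glet ξ a) = glet υ (f a) :=
  gmap_glet f (fun a b => (h a b).1) a

end Groups

end PartComm

namespace PartComm

/-! ### Reduced traces and the action of the group on them. -/

section Reduced

variable {A : Type*} {θ : A → A → Prop}

theorem IsIndependence.ext (hθ : IsIndependence θ) : IsIndependence (extRel θ) :=
  ⟨fun _ => hθ.irrefl _, fun _ _ => hθ.symm _ _⟩

@[simp] theorem base_swap (x : A ⊕ A) : base x.swap = base x := by cases x <;> rfl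

@[simp] theorem extRel_swap_left {x y : A ⊕ A} : extRel θ x.swap y ↔ extRel θ x y := by
  simp [extRel]

@[simp] theorem extRel_swap_right {x y : A ⊕ A} : extRel θ x y.swap ↔ extRel θ x y := by
  simp [extRel]

@[simp] theorem sMap_mlet (x : A ⊕ A) : sMap θ (mlet _ x) = sZero θ x :=
  mlift_mlet _ _ x

theorem sZero_swap (x : A ⊕ A) : sZero θ x.swap = (sZero θ x)⁻¹ := by
  cases x <;> simp [sZero]

/-- One letter of the computation of `t` together with the truth value of `IsRed t`. -/
def redStep (θ : A → A → Prop) (x : A ⊕ A) : Function.End (FPCMonoid (extRel θ) × Prop) :=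
  fun p => (mlet _ x * p.1, p.2 ∧ x.swap ∉ initialAlph p.1)

theorem redStep_comm (hθ : IsIndependence θ) (x y : A ⊕ A) (h : extRel θ x y) :
    redStep θ x * redStep θ y = redStep θ y * redStep θ x := by
  have hyx := hθ.ext.symm _ _ h
  have h1 : x.swap ≠ y := by rintro rfl; exact hθ.ext.irrefl _ (by simpa using h)
  have h2 : y.swap ≠ x := by rintro rfl; exact hθ.ext.irrefl _ (by simpa using h)
  funext ⟨t, P⟩
  change redStep θ x (redStep θ y (t, P)) = redStep θ y (redStep θ x (t, P))
  simp only [redStep, mlet_left_comm h, Prod.mk.injEq, true_and, mem_initialAlph_mlet_mul hθ.ext,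
    extRel_swap_left, h, hyx, h1, h2, false_or]
  exact propext (by tauto)

/-- A trace without factor `x x̄`. -/
def IsRed (hθ : IsIndependence θ) (t : FPCMonoid (extRel θ)) : Prop :=
  (mlift (redStep θ) (redStep_comm hθ) t (1, True)).2

theorem mlift_redStep_fst (hθ : IsIndependence θ) (t : FPCMonoid (extRel θ)) :
    (mlift (redStep θ) (redStep_comm hθ) t (1, True)).1 = t := by
  induction t using trace_induction with
  | one => simp; rfl
  | mul c t ih =>
    rw [map_mul, mlift_mlet]
    change mlet _ c * _ = _
    rw [ih]

theorem isRed_one (hθ : IsIndependence θ) : IsRed hθ 1 := by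
  rw [IsRed, map_one]
  exact trivial

theorem isRed_mlet_mul (hθ : IsIndependence θ) {x : A ⊕ A} {t : FPCMonoid (extRel θ)} :
    IsRed hθ (mlet _ x * t) ↔ IsRed hθ t ∧ x.swap ∉ initialAlph t := by
  rw [IsRed, map_mul, mlift_mlet]
  change (redStep θ x (mlift (redStep θ) _ t (1, True))).2 ↔ _
  rw [redStep, mlift_redStep_fst hθ, IsRed]

/-- A shorter replacement of a suffix, or a cancellation of a letter against its inverse, would
shorten the whole trace. -/
theorem isRed_of_mem_reduced (hθ : IsIndependence θ) {t : FPCMonoid (extRel θ)}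
    (ht : t ∈ reduced θ) : IsRed hθ t := by
  induction t using trace_induction with
  | one => exact isRed_one hθ
  | mul x t ih =>
    rw [isRed_mlet_mul]
    constructor
    · refine ih fun t' h' => ?_
      have := ht (mlet _ x * t') (by rw [map_mul, map_mul, h'])
      simpa using this
    · rintro ⟨p, rfl⟩
      have := ht p (by simp [sZero_swap])
      simp only [length_mul, length_mlet] at this
      omega

open Classical in
/-- Left multiplication by a letter, followed by cancellation. -/
noncomputable def reduceMul (x : A ⊕ A) (t : FPCMonoid (extRel θ)) : FPCMonoid (extRel θ) :=
  if h : x.swap ∈ initialAlph t then h.choose else mlet _ x * t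

theorem reduceMul_of_notMem {x : A ⊕ A} {t : FPCMonoid (extRel θ)}
    (h : x.swap ∉ initialAlph t) : reduceMul x t = mlet _ x * t :=
  dif_neg h

theorem reduceMul_swap (hθ : IsIndependence θ) (x : A ⊕ A) (t : FPCMonoid (extRel θ)) :
    reduceMul x (mlet _ x.swap * t) = t := by
  have h : x.swap ∈ initialAlph (mlet _ x.swap * t) := ⟨t, rfl⟩
  rw [reduceMul, dif_pos h]
  exact (mlet_mul_cancel hθ.ext h.choose_spec).symm

theorem isRed_reduceMul (hθ : IsIndependence θ) {x : A ⊕ A} {t : FPCMonoid (extRel θ)}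
    (ht : IsRed hθ t) : IsRed hθ (reduceMul x t) := by
  by_cases h : x.swap ∈ initialAlph t
  · obtain ⟨p, rfl⟩ := h
    rw [reduceMul_swap hθ]
    exact (isRed_mlet_mul hθ).1 ht |>.1
  · rw [reduceMul_of_notMem h]
    exact (isRed_mlet_mul hθ).2 ⟨ht, h⟩

theorem reduceMul_reduceMul_swap (hθ : IsIndependence θ) {x : A ⊕ A} {t : FPCMonoid (extRel θ)}
    (ht : IsRed hθ t) : reduceMul x (reduceMul x.swap t) = t := by
  by_cases h : x ∈ initialAlph t
  · obtain ⟨p, rfl⟩ := h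
    have := reduceMul_swap hθ x.swap p
    rw [Sum.swap_swap] at this
    rw [this, reduceMul_of_notMem ((isRed_mlet_mul hθ).1 ht).2]
  · rw [reduceMul_of_notMem (x := x.swap) (by simpa using h), reduceMul_swap hθ]

/-- Related letters have different bases, so neither creates nor blocks a cancellation of the other.
This is what lets the group relations act. -/
theorem reduceMul_comm (hθ : IsIndependence θ) {x y : A ⊕ A} (h : extRel θ x y)
    (t : FPCMonoid (extRel θ)) :
    reduceMul x (reduceMul y t) = reduceMul y (reduceMul x t) := by
  have hne : ∀ {x y : A ⊕ A}, extRel θ x y → x.swap ≠ y := by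
    rintro x _ h rfl
    exact hθ.ext.irrefl _ (by simpa using h)
  have hmem : ∀ {x y : A ⊕ A}, extRel θ x y → ∀ t : FPCMonoid (extRel θ),
      x.swap ∈ initialAlph (mlet _ y * t) ↔ x.swap ∈ initialAlph t := by
    intro x y h t
    simp [mem_initialAlph_mlet_mul hθ.ext, h, hne h]
  have key : ∀ {x y : A ⊕ A}, extRel θ x y → ∀ t : FPCMonoid (extRel θ),
      y.swap ∉ initialAlph t → reduceMul x (mlet _ y * t) = mlet _ y * reduceMul x t := by
    intro x y h t ht
    by_cases hx : x.swap ∈ initialAlph t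
    · obtain ⟨p, rfl⟩ := hx
      rw [mlet_left_comm (a := y) (by simpa using hθ.ext.symm _ _ h), reduceMul_swap hθ,
        reduceMul_swap hθ]
    · rw [reduceMul_of_notMem hx, reduceMul_of_notMem (by rwa [hmem h]), mlet_left_comm h]
  have hyx := hθ.ext.symm _ _ h
  have hsw : ∀ {x y : A ⊕ A}, extRel θ x y → ∀ p : FPCMonoid (extRel θ),
      x.swap ∉ initialAlph p → reduceMul x (mlet _ y.swap * p) = mlet _ y.swap * reduceMul x p := by
    intro x y h p hp
    have hxy' : extRel θ x y.swap := by simpa using h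
    rw [reduceMul_of_notMem (by rwa [hmem hxy']), reduceMul_of_notMem hp, mlet_left_comm hxy']
  by_cases hx : x.swap ∈ initialAlph t
  · obtain ⟨p, rfl⟩ := hx
    rw [reduceMul_swap hθ]
    by_cases hy : y.swap ∈ initialAlph p
    · obtain ⟨q, rfl⟩ := hy
      rw [mlet_left_comm (by simpa using h), reduceMul_swap hθ, reduceMul_swap hθ,
        reduceMul_swap hθ]
    · rw [hsw hyx p hy, reduceMul_swap hθ]
  · rw [reduceMul_of_notMem hx]
    rw [key hyx t hx]
    by_cases hy : y.swap ∈ initialAlph t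
    · obtain ⟨p, rfl⟩ := hy
      rw [reduceMul_swap hθ, reduceMul_of_notMem]
      have hxy' : extRel θ x y.swap := by simpa using h
      rwa [hmem hxy'] at hx
    · rw [reduceMul_of_notMem hy, reduceMul_of_notMem (by rwa [hmem h])]

/-- `reduceMul` as a permutation of the traces without factor `x x̄`. -/
noncomputable def redPerm (hθ : IsIndependence θ) (x : A ⊕ A) :
    Equiv.Perm {t : FPCMonoid (extRel θ) // IsRed hθ t} where
  toFun t := ⟨reduceMul x t.1, isRed_reduceMul hθ t.2⟩
  invFun t := ⟨reduceMul x.swap t.1, isRed_reduceMul hθ t.2⟩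
  left_inv t := Subtype.ext (by
    simpa using reduceMul_reduceMul_swap hθ (x := x.swap) t.2)
  right_inv t := Subtype.ext (reduceMul_reduceMul_swap hθ t.2)

/-- The action of `F(A,θ)` on the traces without factor `x x̄`. -/
noncomputable def redAction (hθ : IsIndependence θ) :
    FPCGroup θ →* Equiv.Perm {t : FPCMonoid (extRel θ) // IsRed hθ t} :=
  glift (fun a => redPerm hθ (Sum.inl a)) fun a b h => by
    ext t
    exact congrArg _ (Subtype.ext (reduceMul_comm hθ (x := Sum.inl a) (y := Sum.inl b) h t.1))

theorem redAction_sZero (hθ : IsIndependence θ) (x : A ⊕ A) :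
    redAction hθ (sZero θ x) = redPerm hθ x := by
  cases x with
  | inl a => exact glift_glet _ _ a
  | inr a =>
    rw [sZero, map_inv, redAction, glift_glet]
    rfl

/-- No cancellation occurs while a trace of this kind is built up from the empty one. Such a trace
is therefore determined by its image in the group. -/
theorem redAction_sMap_one (hθ : IsIndependence θ) {t : FPCMonoid (extRel θ)}
    (ht : IsRed hθ t) : redAction hθ (sMap θ t) ⟨1, isRed_one hθ⟩ = ⟨t, ht⟩ := by
  induction t using trace_induction with
  | one => simp
  | mul x t ih =>
    have h := (isRed_mlet_mul hθ).1 ht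
    rw [map_mul, map_mul, Equiv.Perm.mul_apply, ih h.1, sMap_mlet, redAction_sZero]
    exact Subtype.ext (reduceMul_of_notMem h.2)

/-- No letter over `E` starts `w`, so any cancellation takes place inside `m` and leaves `w`
untouched. -/
theorem reduceMul_mul (hθ : IsIndependence θ) {E : Set A} {x : A ⊕ A} (hx : x ∈ extSet E)
    {m w : FPCMonoid (extRel θ)} (hm : m ∈ subTraces (extRel θ) (extSet E))
    (hE : ∀ y ∈ initialAlph w, y ∉ extSet E) :
    ∃ m' ∈ subTraces (extRel θ) (extSet E), reduceMul x (m * w) = m' * w := by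
  by_cases h : x.swap ∈ initialAlph (m * w)
  · rcases (mem_initialAlph_mul hθ.ext).1 h with h' | h'
    · obtain ⟨p, rfl⟩ := h'
      refine ⟨p, ?_, by rw [mul_assoc, reduceMul_swap hθ]⟩
      rw [mem_subTraces_iff] at hm ⊢
      exact fun y hy => hm (by simp [hy])
    · exact absurd (show base x.swap ∈ E by rw [base_swap]; exact hx) (hE _ h'.2)
  · exact ⟨mlet _ x * m, mul_mem (Submonoid.subset_closure ⟨x, hx, rfl⟩) hm,
      by rw [reduceMul_of_notMem h, mul_assoc]⟩

theorem exists_redAction_eq_mul (hθ : IsIndependence θ) {E : Set A} {c : FPCGroup θ}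
    (hc : c ∈ Subgroup.closure (glet θ '' E)) {w : FPCMonoid (extRel θ)} (hw : IsRed hθ w)
    (hE : ∀ y ∈ initialAlph w, y ∉ extSet E) :
    ∃ m ∈ subTraces (extRel θ) (extSet E), (redAction hθ c ⟨w, hw⟩).1 = m * w := by
  induction hc using Subgroup.closure_induction_left with
  | one => exact ⟨1, one_mem _, by simp⟩
  | mul_left x hx y _ ih =>
    obtain ⟨a, ha, rfl⟩ := hx
    obtain ⟨m, hm, h⟩ := ih
    rw [map_mul, Equiv.Perm.mul_apply, show glet θ a = sZero θ (Sum.inl a) from rfl,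
      redAction_sZero]
    obtain ⟨m', hm', h'⟩ := reduceMul_mul hθ (x := Sum.inl a) ha hm hE
    exact ⟨m', hm', by rw [← h', ← h]; rfl⟩
  | inv_mul_cancel x hx y _ ih =>
    obtain ⟨a, ha, rfl⟩ := hx
    obtain ⟨m, hm, h⟩ := ih
    rw [map_mul, Equiv.Perm.mul_apply, show (glet θ a)⁻¹ = sZero θ (Sum.inr a) from rfl,
      redAction_sZero]
    obtain ⟨m', hm', h'⟩ := reduceMul_mul hθ (x := Sum.inr a) ha hm hE
    exact ⟨m', hm', by rw [← h', ← h]; rfl⟩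

/-- The minimal trace of a coset of a standard subgroup of `F(A,θ)` is unique. -/
theorem eq_of_coset (hθ : IsIndependence θ) {E : Set A} {c : FPCGroup θ}
    (hc : c ∈ Subgroup.closure (glet θ '' E)) {w w' : FPCMonoid (extRel θ)}
    (hw : IsRed hθ w) (hw' : IsRed hθ w')
    (hE : ∀ y ∈ initialAlph w, y ∉ extSet E) (hE' : ∀ y ∈ initialAlph w', y ∉ extSet E)
    (h : sMap θ w' = c * sMap θ w) : w' = w := by
  obtain ⟨m, hm, hmw⟩ := exists_redAction_eq_mul hθ hc hw hE
  rw [← redAction_sMap_one hθ hw, ← Equiv.Perm.mul_apply, ← map_mul, ← h,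
    redAction_sMap_one hθ hw'] at hmw
  change w' = m * w at hmw
  -- A nonempty `m` would give `w'` an initial letter over `E`.
  rcases eq_one_or_eq_mlet_mul m with rfl | ⟨x, p, rfl⟩
  · rw [hmw, one_mul]
  · refine absurd ?_ (hE' x ⟨p * w, by rw [hmw, mul_assoc]⟩)
    exact mem_subTraces_iff.1 hm (by simp)

/-- An initial letter of `w` that commutes with `z` would slide to the front of `zw`. -/
theorem notMem_extSet_of_beta (hθ : IsIndependence θ) {z : A} {w : FPCMonoid (extRel θ)}
    (h : initialAlph (mlet (extRel θ) (Sum.inl z) * w) = {Sum.inl z}) :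
    ∀ y ∈ initialAlph w, y ∉ extSet {a | θ z a} := by
  intro y hy hzy
  have : y ∈ initialAlph (mlet (extRel θ) (Sum.inl z) * w) :=
    (mem_initialAlph_mlet_mul hθ.ext).2 (Or.inr ⟨hθ.symm _ _ hzy, hy⟩)
  rw [h, Set.mem_singleton_iff] at this
  subst this
  exact hθ.irrefl _ hzy

theorem eq_of_mem_betaR (hθ : IsIndependence θ) {B Z : Set A} {z : A}
    {w w' : FPCMonoid (extRel θ)} (hw : mlet _ (Sum.inl z) * w ∈ betaR θ B Z)
    (hw' : mlet _ (Sum.inl z) * w' ∈ betaR θ B Z) {c : FPCGroup θ}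
    (hc : c ∈ Subgroup.closure (glet θ '' {a | θ z a}))
    (h : sMap θ w' = c * sMap θ w) : w' = w := by
  have key : ∀ {w : FPCMonoid (extRel θ)}, mlet _ (Sum.inl z) * w ∈ betaR θ B Z →
      IsRed hθ w ∧ ∀ y ∈ initialAlph w, y ∉ extSet {a | θ z a} := by
    rintro w ⟨⟨z', _, v, _, hv, hz'⟩, hred⟩
    refine ⟨((isRed_mlet_mul hθ).1 (isRed_of_mem_reduced hθ hred)).1, ?_⟩
    have : Sum.inl z ∈ initialAlph (mlet (extRel θ) (Sum.inl z) * w) := ⟨w, rfl⟩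
    rw [hz', Set.mem_singleton_iff] at this
    exact notMem_extSet_of_beta hθ (this ▸ hz')
  exact eq_of_coset hθ hc (key hw).1 (key hw').1 (key hw).2 (key hw').2 h

end Reduced

end PartComm

namespace PartComm

/-! ### The semidirect product decomposition. -/

section Semidirect

variable {A : Type*} {θ : A → A → Prop} {B Z : Set A}

/-- The subgroup of `F(B,θ_B)` generated by the letters that commute with `z`. -/
def starSubgroup (θ : A → A → Prop) (B : Set A) (z : A) : Subgroup (FPCGroup (restrictRel θ B)) :=
  Subgroup.closure (glet (restrictRel θ B) '' {b | θ z b})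

/-- Pairs of a letter `z` of `Z` and a coset of its star in `F(B,θ_B)`. -/
abbrev Vert (θ : A → A → Prop) (B Z : Set A) : Type _ :=
  Σ z : Z, FPCGroup (restrictRel θ B) ⧸ starSubgroup θ B z

/-- Two pairs are related when their letters commute and their cosets meet. -/
def vertRel (θ : A → A → Prop) (B Z : Set A) (v u : Vert θ B Z) : Prop :=
  θ v.1 u.1 ∧ ∃ g : FPCGroup (restrictRel θ B), v.2 = g ∧ u.2 = g

theorem isIndependence_vertRel (hθ : IsIndependence θ) : IsIndependence (vertRel θ B Z) :=
  ⟨fun _ h => hθ.irrefl _ h.1, fun _ _ ⟨h, g, h1, h2⟩ => ⟨hθ.symm _ _ h, g, h2, h1⟩⟩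

theorem vertRel_smul (g : FPCGroup (restrictRel θ B)) {v u : Vert θ B Z} (h : vertRel θ B Z v u) :
    vertRel θ B Z (g • v) (g • u) := by
  obtain ⟨h, k, h1, h2⟩ := h
  refine ⟨h, g * k, ?_, ?_⟩
  · change g • v.2 = _
    rw [h1]; rfl
  · change g • u.2 = _
    rw [h2]; rfl

theorem vertRel_smul_iff (g : FPCGroup (restrictRel θ B)) (v u : Vert θ B Z) :
    vertRel θ B Z v u ↔ vertRel θ B Z (g • v) (g • u) :=
  ⟨vertRel_smul g, fun h => by simpa using vertRel_smul g⁻¹ h⟩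

/-- The automorphism induced by an element of `F(B,θ_B)`. -/
def vertEquiv (θ : A → A → Prop) (B Z : Set A) (g : FPCGroup (restrictRel θ B)) :
    MulAut (FPCGroup (vertRel θ B Z)) :=
  gequiv (ξ := vertRel θ B Z) (υ := vertRel θ B Z) (MulAction.toPerm g) (vertRel_smul_iff g)

theorem vertEquiv_glet (g : FPCGroup (restrictRel θ B)) (v : Vert θ B Z) :
    vertEquiv θ B Z g (glet _ v) = glet _ (g • v) :=
  gequiv_glet (ξ := vertRel θ B Z) (υ := vertRel θ B Z) (MulAction.toPerm g) (vertRel_smul_iff g) v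

/-- The action of `F(B,θ_B)` on the free partially commutative group on `Vert`. -/
def vertAut (θ : A → A → Prop) (B Z : Set A) :
    FPCGroup (restrictRel θ B) →* MulAut (FPCGroup (vertRel θ B Z)) where
  toFun := vertEquiv θ B Z
  map_one' := by
    apply MulEquiv.toMonoidHom_injective
    apply fpcGroup_hom_ext
    intro v
    refine (vertEquiv_glet 1 v).trans ?_
    rw [one_smul]
    rfl
  map_mul' g h := by
    apply MulEquiv.toMonoidHom_injective
    apply fpcGroup_hom_ext
    intro v
    change vertEquiv θ B Z (g * h) (glet _ v) = vertEquiv θ B Z g (vertEquiv θ B Z h (glet _ v))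
    rw [vertEquiv_glet, vertEquiv_glet, vertEquiv_glet, mul_smul]

theorem vertAut_glet (g : FPCGroup (restrictRel θ B)) (v : Vert θ B Z) :
    vertAut θ B Z g (glet _ v) = glet _ (g • v) :=
  vertEquiv_glet g v

@[simp]
theorem subgroupMap_glet (b : B) : subgroupMap θ B (glet _ b) = glet θ b :=
  glift_glet _ _ b

theorem commute_of_mem_starSubgroup {z : A} {c : FPCGroup (restrictRel θ B)}
    (hc : c ∈ starSubgroup θ B z) : Commute (glet θ z) (subgroupMap θ B c) := by
  induction hc using Subgroup.closure_induction with
  | mem x hx =>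
    obtain ⟨b, hb, rfl⟩ := hx
    rw [subgroupMap_glet]
    exact glet_comm hb
  | one => simp
  | mul x y _ _ hx hy => rw [map_mul]; exact hx.mul_right hy
  | inv x _ hx => rw [map_inv]; exact hx.inv_right

/-- The conjugate of `z` by a coset of its star. -/
def vertConj (v : Vert θ B Z) : FPCGroup θ :=
  Quotient.liftOn' v.2 (fun g => subgroupMap θ B g * glet θ v.1 * (subgroupMap θ B g)⁻¹) (by
    intro g h hgh
    rw [QuotientGroup.leftRel_apply] at hgh
    have := (commute_of_mem_starSubgroup (inv_mem hgh)).eq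
    rw [mul_inv_rev, inv_inv, map_mul, map_inv] at this
    rw [mul_inv_eq_iff_eq_mul, mul_assoc, mul_assoc, this]
    group)

theorem vertConj_mk (z : Z) (g : FPCGroup (restrictRel θ B)) :
    vertConj (⟨z, g⟩ : Vert θ B Z) =
      subgroupMap θ B g * glet θ z * (subgroupMap θ B g)⁻¹ :=
  rfl

theorem exists_vert (v : Vert θ B Z) :
    ∃ (z : Z) (g : FPCGroup (restrictRel θ B)), v = ⟨z, g⟩ := by
  obtain ⟨z, p⟩ := v
  obtain ⟨g, rfl⟩ := QuotientGroup.mk_surjective p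
  exact ⟨z, g, rfl⟩

theorem vertConj_comm (v u : Vert θ B Z) (h : vertRel θ B Z v u) :
    vertConj v * vertConj u = vertConj u * vertConj v := by
  obtain ⟨z, p⟩ := v
  obtain ⟨y, q⟩ := u
  obtain ⟨h, g, hp, hq⟩ := h
  rw [show (⟨z, p⟩ : Vert θ B Z) = ⟨z, g⟩ from Sigma.ext rfl (heq_of_eq hp),
    show (⟨y, q⟩ : Vert θ B Z) = ⟨y, g⟩ from Sigma.ext rfl (heq_of_eq hq), vertConj_mk, vertConj_mk, conj_mul, conj_mul, glet_comm h]

/-- The homomorphism that sends each pair to the corresponding conjugate. -/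
def vertHom (θ : A → A → Prop) (B Z : Set A) : FPCGroup (vertRel θ B Z) →* FPCGroup θ :=
  glift vertConj vertConj_comm

@[simp]
theorem vertHom_glet (v : Vert θ B Z) : vertHom θ B Z (glet _ v) = vertConj v :=
  glift_glet _ _ v

theorem vertConj_smul (g : FPCGroup (restrictRel θ B)) (v : Vert θ B Z) :
    vertConj (g • v) = subgroupMap θ B g * vertConj v * (subgroupMap θ B g)⁻¹ := by
  obtain ⟨z, h, rfl⟩ := exists_vert v
  change vertConj (⟨z, ((g * h : FPCGroup (restrictRel θ B)) : _ ⧸ _)⟩ : Vert θ B Z) = _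
  rw [vertConj_mk, vertConj_mk, map_mul]
  group

/-- The homomorphism from the semidirect product to `F(A,θ)`. -/
def fromSemidirect (θ : A → A → Prop) (B Z : Set A) :
    FPCGroup (vertRel θ B Z) ⋊[vertAut θ B Z] FPCGroup (restrictRel θ B) →* FPCGroup θ :=
  SemidirectProduct.lift (vertHom θ B Z) (subgroupMap θ B) (by
    intro g
    apply fpcGroup_hom_ext
    intro v
    change vertHom θ B Z (vertAut θ B Z g (glet _ v)) =
      subgroupMap θ B g * vertHom θ B Z (glet _ v) * (subgroupMap θ B g)⁻¹
    rw [vertAut_glet, vertHom_glet, vertHom_glet, vertConj_smul])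

open Classical in
/-- The image of a letter in the semidirect product. -/
noncomputable def toSemidirectLetter (θ : A → A → Prop) (B Z : Set A) (a : A) :
    FPCGroup (vertRel θ B Z) ⋊[vertAut θ B Z] FPCGroup (restrictRel θ B) :=
  if h : a ∈ B then SemidirectProduct.inr (glet _ ⟨a, h⟩)
  else if h : a ∈ Z then
    SemidirectProduct.inl (glet _ ⟨⟨a, h⟩, ((1 : FPCGroup (restrictRel θ B)) : _ ⧸ _)⟩)
  -- Never reached when `B` and `Z` are complementary.
  else 1

theorem toSemidirectLetter_of_mem {a : A} (h : a ∈ B) :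
    toSemidirectLetter θ B Z a = SemidirectProduct.inr (glet _ ⟨a, h⟩) :=
  dif_pos h

theorem toSemidirectLetter_of_mem_right (hBZ : IsCompl B Z) {a : A} (h : a ∈ Z) :
    toSemidirectLetter θ B Z a =
      SemidirectProduct.inl (glet _ ⟨⟨a, h⟩, ((1 : FPCGroup (restrictRel θ B)) : _ ⧸ _)⟩) := by
  rw [toSemidirectLetter, dif_neg (hBZ.disjoint.notMem_of_mem_right h), dif_pos h]

theorem mem_or_mem_of_isCompl (hBZ : IsCompl B Z) (a : A) : a ∈ B ∨ a ∈ Z := by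
  have : a ∈ B ∪ Z := by
    rw [show B ∪ Z = ⊤ from hBZ.sup_eq_top]; trivial
  exact this

theorem inr_mul_inl (g : FPCGroup (restrictRel θ B)) (v : Vert θ B Z) :
    (SemidirectProduct.inr g * SemidirectProduct.inl (glet _ v) * SemidirectProduct.inr g⁻¹ :
      FPCGroup (vertRel θ B Z) ⋊[vertAut θ B Z] FPCGroup (restrictRel θ B)) =
      SemidirectProduct.inl (glet _ (g • v)) := by
  rw [← vertAut_glet, SemidirectProduct.inl_aut]

/-- The case with content is `b` in `B` against `z` in `Z`: `b` acts on the generator of `z` by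
translating its coset, and fixes the trivial coset because `b` lies in the star of `z`. -/
theorem toSemidirectLetter_comm (hθ : IsIndependence θ) (hBZ : IsCompl B Z) (a b : A)
    (h : θ a b) : toSemidirectLetter θ B Z a * toSemidirectLetter θ B Z b =
      toSemidirectLetter θ B Z b * toSemidirectLetter θ B Z a := by
  have key : ∀ b ∈ B, ∀ z ∈ Z, θ z b → Commute (toSemidirectLetter θ B Z b)
      (toSemidirectLetter θ B Z z) := by
    intro b hb z hz h
    rw [toSemidirectLetter_of_mem hb, toSemidirectLetter_of_mem_right hBZ hz]
    have := inr_mul_inl (glet (restrictRel θ B) ⟨b, hb⟩)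
      (⟨⟨z, hz⟩, ((1 : FPCGroup (restrictRel θ B)) : _ ⧸ _)⟩ : Vert θ B Z)
    rw [map_inv, mul_inv_eq_iff_eq_mul] at this
    refine this.trans ?_
    congr 3
    refine Sigma.ext rfl (heq_of_eq ?_)
    change (((glet _ _ * 1 : FPCGroup (restrictRel θ B))) : _ ⧸ starSubgroup θ B z) = _
    rw [QuotientGroup.eq]
    simp only [mul_one]
    exact inv_mem (Subgroup.subset_closure ⟨⟨b, hb⟩, h, rfl⟩)
  rcases mem_or_mem_of_isCompl hBZ a with ha | ha <;> rcases mem_or_mem_of_isCompl hBZ b with hb | hb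
  · rw [toSemidirectLetter_of_mem ha, toSemidirectLetter_of_mem hb, ← map_mul, ← map_mul,
      glet_comm (show restrictRel θ B ⟨a, ha⟩ ⟨b, hb⟩ from h)]
  · exact key a ha b hb (hθ.symm _ _ h)
  · exact (key b hb a ha h).symm
  · rw [toSemidirectLetter_of_mem_right hBZ ha, toSemidirectLetter_of_mem_right hBZ hb,
      ← map_mul, ← map_mul, glet_comm]
    exact ⟨h, 1, rfl, rfl⟩

/-- The homomorphism from `F(A,θ)` to the semidirect product. -/
noncomputable def toSemidirect (hθ : IsIndependence θ) (hBZ : IsCompl B Z) :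
    FPCGroup θ →* FPCGroup (vertRel θ B Z) ⋊[vertAut θ B Z] FPCGroup (restrictRel θ B) :=
  glift (toSemidirectLetter θ B Z) (toSemidirectLetter_comm hθ hBZ)

theorem toSemidirect_glet (hθ : IsIndependence θ) (hBZ : IsCompl B Z) (a : A) :
    toSemidirect hθ hBZ (glet θ a) = toSemidirectLetter θ B Z a :=
  glift_glet _ _ a

theorem toSemidirect_subgroupMap (hθ : IsIndependence θ) (hBZ : IsCompl B Z)
    (g : FPCGroup (restrictRel θ B)) :
    toSemidirect hθ hBZ (subgroupMap θ B g) = SemidirectProduct.inr g := by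
  have : (toSemidirect hθ hBZ).comp (subgroupMap θ B) = SemidirectProduct.inr := by
    apply fpcGroup_hom_ext
    intro b
    rw [MonoidHom.comp_apply, subgroupMap_glet, toSemidirect_glet, toSemidirectLetter_of_mem b.2]
  exact DFunLike.congr_fun this g

theorem toSemidirect_vertHom (hθ : IsIndependence θ) (hBZ : IsCompl B Z)
    (k : FPCGroup (vertRel θ B Z)) :
    toSemidirect hθ hBZ (vertHom θ B Z k) = SemidirectProduct.inl k := by
  have : (toSemidirect hθ hBZ).comp (vertHom θ B Z) = SemidirectProduct.inl := by
    apply fpcGroup_hom_ext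
    intro v
    obtain ⟨z, g, rfl⟩ := exists_vert v
    rw [MonoidHom.comp_apply, vertHom_glet, vertConj_mk, map_mul, map_mul, map_inv,
      toSemidirect_subgroupMap, toSemidirect_glet, toSemidirectLetter_of_mem_right hBZ z.2,
      ← map_inv, inr_mul_inl]
    congr 2
    refine Sigma.ext rfl (heq_of_eq ?_)
    change (((g * 1 : FPCGroup (restrictRel θ B))) : _ ⧸ starSubgroup θ B z) = _
    rw [mul_one]
  exact DFunLike.congr_fun this k

theorem fromSemidirect_toSemidirect (hθ : IsIndependence θ) (hBZ : IsCompl B Z)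
    (g : FPCGroup θ) : fromSemidirect θ B Z (toSemidirect hθ hBZ g) = g := by
  have : (fromSemidirect θ B Z).comp (toSemidirect hθ hBZ) = MonoidHom.id _ := by
    apply fpcGroup_hom_ext
    intro a
    rw [MonoidHom.comp_apply, toSemidirect_glet, MonoidHom.id_apply, fromSemidirect]
    rcases mem_or_mem_of_isCompl hBZ a with ha | ha
    · rw [toSemidirectLetter_of_mem ha, SemidirectProduct.lift_inr, subgroupMap_glet]
    · rw [toSemidirectLetter_of_mem_right hBZ ha, SemidirectProduct.lift_inl, vertHom_glet,
        vertConj_mk]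
      simp
  exact DFunLike.congr_fun this g

theorem vertHom_injective (hθ : IsIndependence θ) (hBZ : IsCompl B Z) :
    Function.Injective (vertHom θ B Z) := fun k l h =>
  SemidirectProduct.inl_injective (by
    rw [← toSemidirect_vertHom hθ hBZ, ← toSemidirect_vertHom hθ hBZ, h])

theorem subgroupMap_injective (hθ : IsIndependence θ) (hBZ : IsCompl B Z) :
    Function.Injective (subgroupMap θ B) := fun k l h =>
  SemidirectProduct.inr_injective (φ := vertAut θ B Z) (by
    rw [← toSemidirect_subgroupMap hθ hBZ, ← toSemidirect_subgroupMap hθ hBZ, h])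

/-- The retraction of `F(A,θ)` onto `F(B,θ_B)` that kills `Z`. -/
noncomputable def retraction (hθ : IsIndependence θ) (hBZ : IsCompl B Z) :
    FPCGroup θ →* FPCGroup (restrictRel θ B) :=
  SemidirectProduct.rightHom.comp (toSemidirect hθ hBZ)

theorem retraction_subgroupMap (hθ : IsIndependence θ) (hBZ : IsCompl B Z)
    (g : FPCGroup (restrictRel θ B)) : retraction hθ hBZ (subgroupMap θ B g) = g := by
  rw [retraction, MonoidHom.comp_apply, toSemidirect_subgroupMap, SemidirectProduct.rightHom_inr]

theorem retraction_glet (hθ : IsIndependence θ) (hBZ : IsCompl B Z) {z : A} (hz : z ∈ Z) :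
    retraction hθ hBZ (glet θ z) = 1 := by
  rw [retraction, MonoidHom.comp_apply, toSemidirect_glet, toSemidirectLetter_of_mem_right hBZ hz,
    SemidirectProduct.rightHom_inl]

theorem vertConj_mem_HZ (v : Vert θ B Z) : vertConj v ∈ HZ θ Z := by
  obtain ⟨z, g, rfl⟩ := exists_vert v
  exact Subgroup.normalClosure_normal.conj_mem _
    (Subgroup.subset_normalClosure (Set.mem_image_of_mem _ z.2)) _

theorem range_vertHom :
    (vertHom θ B Z).range = Subgroup.closure (Set.range (vertConj (θ := θ) (B := B) (Z := Z))) := by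
  rw [MonoidHom.range_eq_map, ← closure_range_glet, MonoidHom.map_closure, ← Set.range_comp]
  congr 2
  funext v
  exact vertHom_glet v

/-- A cycle of inclusions: the retraction kills `Z`, its kernel corresponds to the normal factor of
the semidirect product, and the generators of that factor map to conjugates of letters of `Z`. -/
theorem HZ_eq_ker (hθ : IsIndependence θ) (hBZ : IsCompl B Z) :
    HZ θ Z = (retraction hθ hBZ).ker ∧ HZ θ Z = (vertHom θ B Z).range := by
  have h1 : HZ θ Z ≤ (retraction hθ hBZ).ker := by
    refine Subgroup.normalClosure_le_normal ?_
    rintro _ ⟨z, hz, rfl⟩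
    exact retraction_glet hθ hBZ hz
  have h2 : (retraction hθ hBZ).ker ≤ (vertHom θ B Z).range := by
    intro g hg
    have hg' : SemidirectProduct.rightHom (toSemidirect hθ hBZ g) = 1 := hg
    rw [← MonoidHom.mem_ker, ← SemidirectProduct.range_inl_eq_ker_rightHom] at hg'
    obtain ⟨k, hk⟩ := hg'
    refine ⟨k, ?_⟩
    rw [← fromSemidirect_toSemidirect hθ hBZ g, ← hk, fromSemidirect, SemidirectProduct.lift_inl]
  have h3 : (vertHom θ B Z).range ≤ HZ θ Z := by
    rw [range_vertHom, Subgroup.closure_le]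
    rintro _ ⟨v, rfl⟩
    exact vertConj_mem_HZ v
  exact ⟨le_antisymm h1 (h2.trans h3), le_antisymm (h1.trans h2) h3⟩

theorem isComplement'_HZ (hθ : IsIndependence θ) (hBZ : IsCompl B Z) :
    Subgroup.IsComplement' (subgroupMap θ B).range (HZ θ Z) := by
  refine Subgroup.isComplement'_of_disjoint_and_mul_eq_univ ?_ ?_
  · rw [Subgroup.disjoint_def]
    rintro _ ⟨g, rfl⟩ hg
    rw [(HZ_eq_ker hθ hBZ).1, MonoidHom.mem_ker, retraction_subgroupMap] at hg
    rw [hg, map_one]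
  · rw [Set.eq_univ_iff_forall]
    intro g
    refine ⟨subgroupMap θ B (retraction hθ hBZ g), ⟨_, rfl⟩,
      (subgroupMap θ B (retraction hθ hBZ g))⁻¹ * g, ?_, by simp⟩
    rw [SetLike.mem_coe, (HZ_eq_ker hθ hBZ).1, MonoidHom.mem_ker, map_mul, map_inv,
      retraction_subgroupMap, inv_mul_cancel]

theorem vertConj_injective (hθ : IsIndependence θ) (hBZ : IsCompl B Z) :
    Function.Injective (vertConj (θ := θ) (B := B) (Z := Z)) := by
  intro v u h
  rw [← vertHom_glet, ← vertHom_glet] at h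
  exact glet_injective (vertHom_injective hθ hBZ h)

/-- The embedding `vertHom` pulls commutation back to the abstract group, where `rel_of_commute`
applies. -/
theorem vertRel_iff (hθ : IsIndependence θ) (hBZ : IsCompl B Z) (v u : Vert θ B Z) :
    vertRel θ B Z v u ↔
      vertConj v * vertConj u = vertConj u * vertConj v ∧ vertConj v ≠ vertConj u := by
  constructor
  · intro h
    refine ⟨vertConj_comm v u h, fun h' => ?_⟩
    rw [vertConj_injective hθ hBZ h'] at h
    exact (isIndependence_vertRel hθ).irrefl _ h
  · rintro ⟨h, hne⟩
    refine rel_of_commute (isIndependence_vertRel hθ) (fun h' => hne (by rw [h'])) ?_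
    apply vertHom_injective hθ hBZ
    simpa using h

end Semidirect

/-! ### The set `ρ_Z(B)` as the set of all conjugates. -/

section Rho

variable {A : Type*} {θ : A → A → Prop} {B Z : Set A}

/-- The exponent sum. -/
def degree (θ : A → A → Prop) : FPCGroup θ →* Multiplicative ℤ :=
  glift (fun _ => Multiplicative.ofAdd 1) fun _ _ _ => rfl

theorem degree_glet (a : A) : degree θ (glet θ a) = Multiplicative.ofAdd 1 := glift_glet _ _ a

theorem glet_ne_one (a : A) : glet θ a ≠ 1 := by
  intro h
  have := congrArg (degree θ) h
  rw [degree_glet, MonoidHom.map_one] at this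
  exact absurd (Multiplicative.ofAdd.injective this) one_ne_zero

theorem sMap_mem_range {w : FPCMonoid (extRel θ)} (hw : w ∈ subTraces (extRel θ) (extSet B)) :
    ∃ g, subgroupMap θ B g = sMap θ w := by
  induction hw using Submonoid.closure_induction with
  | mem x hx =>
    obtain ⟨x, hx, rfl⟩ := hx
    rcases x with b | b
    · exact ⟨glet _ ⟨b, hx⟩, by simp [sZero]⟩
    · exact ⟨(glet _ ⟨b, hx⟩)⁻¹, by simp [sZero]⟩
  | one => exact ⟨1, by simp⟩
  | mul x y _ _ hx hy =>
    obtain ⟨g, hg⟩ := hx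
    obtain ⟨h, hh⟩ := hy
    exact ⟨g * h, by simp [hg, hh]⟩

theorem exists_sMap_eq (g : FPCGroup (restrictRel θ B)) :
    ∃ w ∈ subTraces (extRel θ) (extSet B), sMap θ w = subgroupMap θ B g := by
  have hg : g ∈ Subgroup.closure (Set.range (glet (restrictRel θ B))) :=
    closure_range_glet (ξ := restrictRel θ B) ▸ Subgroup.mem_top g
  induction hg using Subgroup.closure_induction_left with
  | one => exact ⟨1, one_mem _, by simp⟩
  | mul_left x hx y _ ih =>
    obtain ⟨b, rfl⟩ := hx
    obtain ⟨w, hw, h⟩ := ih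
    exact ⟨mlet (extRel θ) (Sum.inl b.1) * w,
      mul_mem (Submonoid.subset_closure ⟨Sum.inl b.1, b.2, rfl⟩) hw,
      by simp [h, sZero]⟩
  | inv_mul_cancel x hx y _ ih =>
    obtain ⟨b, rfl⟩ := hx
    obtain ⟨w, hw, h⟩ := ih
    exact ⟨mlet (extRel θ) (Sum.inr b.1) * w,
      mul_mem (Submonoid.subset_closure ⟨Sum.inr b.1, b.2, rfl⟩) hw,
      by simp [h, sZero]⟩

/-- Deleting the letters over `Z` realizes the retraction on traces. The length drops strictly
unless there was nothing to delete. -/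
theorem exists_retraction_trace (hθ : IsIndependence θ) (hBZ : IsCompl B Z)
    (t : FPCMonoid (extRel θ)) :
    ∃ t' ∈ subTraces (extRel θ) (extSet B),
      sMap θ t' = subgroupMap θ B (retraction hθ hBZ (sMap θ t)) ∧
      (length t' < length t ∨ t' = t) := by
  induction t using trace_induction with
  | one => exact ⟨1, one_mem _, by simp, Or.inr rfl⟩
  | mul x t ih =>
    obtain ⟨t', ht', h, hl⟩ := ih
    rcases mem_or_mem_of_isCompl hBZ (base x) with hx | hx
    · have hx' : mlet (extRel θ) x ∈ subTraces (extRel θ) (extSet B) :=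
        Submonoid.subset_closure ⟨x, hx, rfl⟩
      refine ⟨mlet _ x * t', mul_mem hx' ht', ?_, ?_⟩
      · obtain ⟨g, hg⟩ := sMap_mem_range hx'
        rw [map_mul, h, map_mul, map_mul, map_mul, ← hg, retraction_subgroupMap]
      · rcases hl with hl | rfl
        · left; simpa using hl
        · exact Or.inr rfl
    · refine ⟨t', ht', ?_, Or.inl ?_⟩
      · have : retraction hθ hBZ (sZero θ x) = 1 := by
          rcases x with z | z
          · exact retraction_glet hθ hBZ hx
          · rw [sZero, map_inv, retraction_glet hθ hBZ (z := z) hx, inv_one]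
        rw [h, map_mul, map_mul, sMap_mlet, this, one_mul]
      · have : length t' ≤ length t := by
          rcases hl with hl | rfl
          · exact hl.le
          · exact le_rfl
        simp only [length_mul, length_mlet]
        omega

theorem vertConj_inv_mk (z : Z) {g : FPCGroup (restrictRel θ B)} {w : FPCMonoid (extRel θ)}
    (hg : subgroupMap θ B g = sMap θ w) :
    vertConj (⟨z, (g⁻¹ : FPCGroup (restrictRel θ B))⟩ : Vert θ B Z) =
      (sMap θ w)⁻¹ * glet θ z * sMap θ w := by
  rw [vertConj_mk, map_inv, hg, inv_inv]

/-- `ρ_Z(B)` consists of all conjugates of letters of `Z` by elements of `F(B,θ_B)`. -/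
theorem rho_eq_range (hθ : IsIndependence θ) (hBZ : IsCompl B Z) :
    rho θ B Z = Set.range (vertConj (θ := θ) (B := B) (Z := Z)) := by
  apply Set.Subset.antisymm
  · rintro _ ⟨z, hz, w, hw, _, rfl⟩
    obtain ⟨g, hg⟩ := sMap_mem_range hw
    exact ⟨_, vertConj_inv_mk ⟨z, hz⟩ hg⟩
  · rintro _ ⟨v, rfl⟩
    let S : Set (FPCMonoid (extRel θ)) := {w | w ∈ subTraces (extRel θ) (extSet B) ∧
      vertConj v = (sMap θ w)⁻¹ * glet θ v.1 * sMap θ w}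
    have hS : S.Nonempty := by
      obtain ⟨z, g, rfl⟩ := exists_vert v
      obtain ⟨w, hw, h⟩ := exists_sMap_eq g⁻¹
      refine ⟨w, hw, ?_⟩
      rw [h, vertConj_mk, map_inv, inv_inv]
    -- A shortest conjugating trace is taken: an initial letter commuting with `z` could be dropped
    -- from it, so `IA(zw) = {z}`.
    obtain ⟨w, ⟨hw, hv⟩, hmin⟩ := (measure (length (θ := extRel θ))).wf.has_min S hS
    replace hmin : ∀ t ∈ S, length w ≤ length t := fun t ht => not_lt.1 (hmin t ht)
    refine ⟨v.1, v.1.2, w, hw, ⟨⟨_, ⟨_, v.1.2, rfl⟩, w, hw, rfl, ?_⟩, ?_⟩, hv⟩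
    · ext x
      rw [mem_initialAlph_mlet_mul hθ.ext, Set.mem_singleton_iff, or_iff_left_iff_imp]
      rintro ⟨hx, p, rfl⟩
      have hxv : Commute (sZero θ x) (glet θ v.1) := sZero_comm (y := Sum.inl v.1.1) hx
      rw [mem_subTraces_iff, alph_mul] at hw
      have := hmin p ⟨mem_subTraces_iff.2 fun y hy => hw (Or.inr hy), by
        rw [hv, map_mul, sMap_mlet, mul_inv_rev]
        calc _ = (sMap θ p)⁻¹ * ((sZero θ x)⁻¹ * (glet θ v.1 * sZero θ x)) * sMap θ p := by group
          _ = _ := by rw [← hxv.eq]; group⟩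
      simp only [length_mul, length_mlet] at this
      omega
    · intro t ht
      -- For `zw` to be reduced, a competitor `t` must have length at least `length w + 1`. Its part
      -- over `B` maps to `s(w)`, so it is at least as long as `w`. The extra letter is one deleted
      -- from `t`; if none was deleted, then `z` would be trivial in the group.
      obtain ⟨t', ht', h, hl⟩ := exists_retraction_trace hθ hBZ t
      obtain ⟨g, hg⟩ := sMap_mem_range hw
      have hs : sMap θ t' = sMap θ w := by
        rw [h, ht, map_mul, map_mul, sMap_mlet, sZero, retraction_glet hθ hBZ v.1.2, one_mul, ← hg,
          retraction_subgroupMap]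
      have hle := hmin t' ⟨ht', by rw [hs]; exact hv⟩
      rcases hl with hl | rfl
      · simp only [length_mul, length_mlet]
        omega
      · rw [hs, map_mul, sMap_mlet, eq_comm, mul_eq_right] at ht
        exact absurd ht (glet_ne_one _)

end Rho

end PartComm

namespace PartComm

/-! ### The code property as a condition on paths through `B`. -/

section Codes

variable {A : Type*} {θ : A → A → Prop} {B Z : Set A}

/-- The letters at the end of a path `z, b₁, …, bₙ` with `bᵢ ∈ B` in which consecutive letters do
not commute. -/
inductive Reach (θ : A → A → Prop) (B : Set A) (z : A) : A → Prop
  | start {b : A} : b ∈ B → ¬ θ z b → Reach θ B z b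
  | step {b c : A} : Reach θ B z b → c ∈ B → ¬ θ b c → Reach θ B z c

/-- No two commuting letters of `Z` are joined by a path through `B` of noncommuting letters. -/
def Separated (θ : A → A → Prop) (B Z : Set A) : Prop :=
  ∀ z ∈ Z, ∀ z' ∈ Z, θ z z' → ∀ b, Reach θ B z b → θ z' b

theorem Reach.mem {z b : A} (h : Reach θ B z b) : b ∈ B := by
  cases h <;> assumption

/-- If the last letter is unreachable, it commutes with `z` and with all earlier letters, which are
reachable by induction. It then slides to the front and is a second initial letter. -/
theorem reach_of_mem_alph (hθ : IsIndependence θ) {z : A} {w : FPCMonoid θ}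
    (hw : w ∈ subTraces θ B) (h : initialAlph (mlet θ z * w) ⊆ {z}) :
    ∀ c ∈ alph w, Reach θ B z c := by
  rw [mem_subTraces_iff] at hw
  induction w using trace_induction_right with
  | one => simp
  | mul w b ih =>
    simp only [alph_mul, alph_mlet, Set.union_subset_iff, Set.singleton_subset_iff] at hw
    replace ih := ih hw.1 fun a ha => h (by
      rw [← mul_assoc]
      exact (mem_initialAlph_mul hθ).2 (Or.inl ha))
    intro c hc
    rw [alph_mul, alph_mlet] at hc
    rcases hc with hc | rfl
    · exact ih c hc
    by_contra hR
    have hall : ∀ d ∈ alph (mlet θ z * w), θ c d := by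
      intro d hd
      rw [alph_mul, alph_mlet] at hd
      by_contra hcd
      rcases hd with rfl | hd
      · exact hR (Reach.start hw.2 fun h' => hcd (hθ.symm _ _ h'))
      · exact hR (Reach.step (ih d hd) hw.2 fun h' => hcd (hθ.symm _ _ h'))
    have hc : c ∈ initialAlph (mlet θ z * (w * mlet θ c)) := by
      rw [← mul_assoc]
      exact (mem_initialAlph_mul hθ).2 (Or.inr ⟨hall, by rw [initialAlph_mlet hθ]; rfl⟩)
    have : c = z := h hc
    subst this
    exact hθ.irrefl _ (hall c (by simp))

/-- A letter reached from both sides lets the path from `z` run backwards along the path from `z'`,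
up to a letter not commuting with `z'`. -/
theorem Separated.not_reach (hθ : IsIndependence θ) (hsep : Separated θ B Z) {z z' b : A}
    (hz : z ∈ Z) (hz' : z' ∈ Z) (hzz : θ z z') (hb' : Reach θ B z' b) : ¬ Reach θ B z b := by
  induction hb' with
  | start _ h => exact fun hb => h (hsep z hz z' hz' hzz _ hb)
  | step hb _ hbc ih => exact fun hc => ih (hc.step hb.mem fun h => hbc (hθ.symm _ _ h))

theorem Separated.forall_rel (hθ : IsIndependence θ) (hsep : Separated θ B Z) {z z' : A}
    (hz : z ∈ Z) (hz' : z' ∈ Z) (hzz : θ z z') {w w' : FPCMonoid θ}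
    (hw : w ∈ subTraces θ B) (hw' : w' ∈ subTraces θ B)
    (h : initialAlph (mlet θ z * w) = {z}) (h' : initialAlph (mlet θ z' * w') = {z'}) :
    ∀ a ∈ alph (mlet θ z * w), ∀ b ∈ alph (mlet θ z' * w'), θ a b := by
  have hR := reach_of_mem_alph hθ hw h.subset
  have hR' := reach_of_mem_alph hθ hw' h'.subset
  intro a ha b hb
  rw [alph_mul, alph_mlet] at ha hb
  rcases ha with rfl | ha <;> rcases hb with rfl | hb
  · exact hzz
  · exact hsep z' hz' a hz (hθ.symm _ _ hzz) b (hR' b hb)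
  · exact hθ.symm _ _ (hsep z hz b hz' hzz a (hR a ha))
  · by_contra hab
    exact hsep.not_reach hθ hz hz' hzz (hR' b hb) ((hR a ha).step (hR' b hb).mem hab)

theorem isIndependence_traceRel (hθ : IsIndependence θ) {X : Set (FPCMonoid θ)}
    (hX : ∀ x ∈ X, (alph x).Nonempty) : IsIndependence (traceRel X) :=
  ⟨fun x h => by
    obtain ⟨a, ha⟩ := hX x x.2
    exact hθ.irrefl a (h a ha a ha), fun _ _ h a ha b hb => hθ.symm _ _ (h b hb a ha)⟩

theorem alph_nonempty_of_mem_beta {x : FPCMonoid θ} (hx : x ∈ beta θ B Z) :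
    (alph x).Nonempty := by
  obtain ⟨z, _, w, _, rfl, _⟩ := hx
  exact ⟨z, by simp⟩

/-- The morphism from `M(X,θ_X)` to `M(A,θ)`. -/
def evalCode (X : Set (FPCMonoid θ)) : FPCMonoid (traceRel X) →* FPCMonoid θ :=
  mlift (fun x => x.1) fun _ _ h => (commute_of_alph h).eq

theorem isPCCode_of_injective {X : Set (FPCMonoid θ)} (h : Function.Injective (evalCode X)) :
    IsPCCode X :=
  fun _ _ huv => h huv

/-- The left factor is the maximal prefix over `B`. Once the leading `z` is cancelled, this recovers
the `B`-part of the first code word. -/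
theorem factorization_unique (hθ : IsIndependence θ) {w w' s t : FPCMonoid θ}
    (hw : w ∈ subTraces θ B) (hw' : w' ∈ subTraces θ B)
    (hs : Disjoint B (initialAlph s)) (ht : Disjoint B (initialAlph t))
    (h : w * s = w' * t) : w = w' ∧ s = t := by
  rw [mem_subTraces_iff] at hw hw'
  induction w using trace_induction generalizing w' with
  | one =>
    rcases eq_one_or_eq_mlet_mul w' with rfl | ⟨b, p, rfl⟩
    · simpa using h
    · refine absurd ?_ (hs.notMem_of_mem_left (hw' (show b ∈ _ by simp)))
      exact ⟨p * t, by rw [← mul_assoc, ← h, one_mul]⟩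
  | mul b p ih =>
    have hb : b ∈ initialAlph (w' * t) := ⟨p * s, by rw [← h, mul_assoc]⟩
    rcases (mem_initialAlph_mul hθ).1 hb with ⟨p', rfl⟩ | hb
    · rw [mul_assoc, mul_assoc] at h
      obtain ⟨rfl, rfl⟩ := ih (fun a ha => hw (by simp [ha])) (fun a ha => hw' (by simp [ha]))
        (mlet_mul_cancel hθ h)
      exact ⟨rfl, rfl⟩
    · exact absurd hb.2 (ht.notMem_of_mem_left (hw (by simp)))

theorem evalCode_mlet_mul {X : Set (FPCMonoid θ)} (x : X) (t : FPCMonoid (traceRel X)) :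
    evalCode X (mlet _ x * t) = x.1 * evalCode X t := by
  rw [evalCode, map_mul, mlift_mlet]

theorem initialAlph_evalCode (hθ : IsIndependence θ) (t : FPCMonoid (traceRel (beta θ B Z))) :
    initialAlph (evalCode _ t) ⊆ Z := by
  induction t using trace_induction with
  | one => simp
  | mul x t ih =>
    intro a ha
    rw [evalCode_mlet_mul] at ha
    rcases (mem_initialAlph_mul hθ).1 ha with ha | ha
    · obtain ⟨z, hz, w, _, _, h⟩ := x.2
      rw [h] at ha
      exact (Set.mem_singleton_iff.1 ha) ▸ hz
    · exact ih ha.2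

/-- The factor that contributes `z` can be moved to the front: `z` commutes with the leading letter
of every factor before it, and by separation the whole factors then commute. -/
theorem exists_factor_of_mem_initialAlph (hθ : IsIndependence θ)
    (hsep : Separated θ B Z) {z : A} (hz : z ∈ Z) (t : FPCMonoid (traceRel (beta θ B Z)))
    (ht : z ∈ initialAlph (evalCode _ t)) :
    ∃ (y : beta θ B Z) (t' : FPCMonoid (traceRel (beta θ B Z))),
      t = mlet _ y * t' ∧ initialAlph y.1 = {z} := by
  induction t using trace_induction with
  | one => simp at ht
  | mul x t ih =>
    obtain ⟨y, hy, w, hw, hx, hIA⟩ := x.2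
    rw [evalCode_mlet_mul] at ht
    rcases (mem_initialAlph_mul hθ).1 ht with hzx | ⟨hall, hzt⟩
    · rw [hIA, Set.mem_singleton_iff] at hzx
      exact ⟨x, t, rfl, by rw [hIA, hzx]⟩
    · obtain ⟨x', t', rfl, hx'⟩ := ih hzt
      refine ⟨x', mlet _ x * t', mlet_left_comm ?_ t', hx'⟩
      obtain ⟨z', hz', w', hw', hxw', hIA'⟩ := x'.2
      rw [hx', Set.singleton_eq_singleton_iff] at hIA'
      subst hIA'
      intro a ha b hb
      rw [hx] at ha
      rw [hxw'] at hb
      refine hsep.forall_rel hθ hy hz ?_ hw hw' (hx ▸ hIA) (hxw' ▸ hx') a ha b hb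
      exact hθ.symm _ _ (hall y (by rw [hx]; simp))

theorem Separated.isPCCode (hθ : IsIndependence θ) (hBZ : Disjoint B Z)
    (hsep : Separated θ B Z) : IsPCCode (beta θ B Z) := by
  apply isPCCode_of_injective
  intro s t h
  induction t using trace_induction generalizing s with
  | one =>
    rcases eq_one_or_eq_mlet_mul s with rfl | ⟨x, p, rfl⟩
    · rfl
    · obtain ⟨a, ha⟩ := alph_nonempty_of_mem_beta x.2
      rw [evalCode_mlet_mul, map_one] at h
      have := congrArg alph h
      rw [alph_mul, alph_one] at this
      exact absurd (this ▸ Or.inl ha : a ∈ (∅ : Set A)) (Set.notMem_empty a)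
  | mul x t ih =>
    obtain ⟨z, hz, w, hw, hx, hIA⟩ := x.2
    have hzs : z ∈ initialAlph (evalCode _ s) := by
      rw [h, evalCode_mlet_mul, hx, mul_assoc]
      exact ⟨_, rfl⟩
    obtain ⟨y, s', rfl, hy⟩ := exists_factor_of_mem_initialAlph hθ hsep hz s hzs
    obtain ⟨z', hz', w', hw', hyw', hIA'⟩ := y.2
    rw [hy, Set.singleton_eq_singleton_iff] at hIA'
    subst hIA'
    rw [evalCode_mlet_mul, evalCode_mlet_mul, hx, hyw', mul_assoc, mul_assoc] at h
    obtain ⟨hww, hst⟩ := factorization_unique hθ hw' hw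
      (hBZ.mono_right (initialAlph_evalCode hθ _)) (hBZ.mono_right (initialAlph_evalCode hθ _))
      (mlet_mul_cancel hθ h)
    rw [ih hst, show y = x from Subtype.ext (by rw [hyw', hx, hww])]

theorem initialAlph_mul_mlet (hθ : IsIndependence θ) {z : A} {t : FPCMonoid θ} {b : A}
    (h : initialAlph t = {z}) (hb : ∃ a ∈ alph t, ¬ θ a b) :
    initialAlph (t * mlet θ b) = {z} := by
  rw [← h]
  ext c
  rw [mem_initialAlph_mul hθ, initialAlph_mlet hθ, or_iff_left_iff_imp]
  rintro ⟨hall, rfl⟩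
  obtain ⟨a, ha, hab⟩ := hb
  exact absurd (hθ.symm _ _ (hall a ha)) hab

/-- A shortest path from `z` to a letter that does not commute with `z'`. -/
theorem Reach.exists_trace (hθ : IsIndependence θ) {z z' b : A} (h : Reach θ B z b)
    (hb : ¬ θ z' b) :
    ∃ w ∈ subTraces θ B, ∃ c ∈ B, (∀ a ∈ alph w, θ z' a) ∧ ¬ θ z' c ∧
      initialAlph (mlet θ z * w) = {z} ∧ initialAlph (mlet θ z * (w * mlet θ c)) = {z} := by
  -- Along the path, either a letter not commuting with `z'` has already been met, or all letters
  -- before the current one commute with `z'`.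
  suffices key : ∀ b, Reach θ B z b →
      (∃ w ∈ subTraces θ B, ∃ c ∈ B, (∀ a ∈ alph w, θ z' a) ∧ ¬ θ z' c ∧
        initialAlph (mlet θ z * w) = {z} ∧ initialAlph (mlet θ z * (w * mlet θ c)) = {z}) ∨
      ∃ w ∈ subTraces θ B, (∀ a ∈ alph w, θ z' a) ∧
        initialAlph (mlet θ z * w) = {z} ∧ initialAlph (mlet θ z * (w * mlet θ b)) = {z} by
    rcases key b h with h' | ⟨w, hw, h1, h2, h3⟩
    · exact h'
    · exact ⟨w, hw, b, h.mem, h1, hb, h2, h3⟩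
  intro b h
  induction h with
  | start hb hzb =>
    refine Or.inr ⟨1, one_mem _, by simp, by rw [mul_one, initialAlph_mlet hθ], ?_⟩
    rw [one_mul]
    exact initialAlph_mul_mlet hθ (initialAlph_mlet hθ z) ⟨z, by simp, hzb⟩
  | @step b c hb hc hbc ih =>
    rcases ih with ih | ⟨w, hw, h1, h2, h3⟩
    · exact Or.inl ih
    by_cases hzb : θ z' b
    · refine Or.inr ⟨w * mlet θ b, mul_mem hw (Submonoid.subset_closure ⟨b, hb.mem, rfl⟩),
        ?_, h3, ?_⟩
      · intro a ha
        rw [alph_mul, alph_mlet] at ha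
        rcases ha with ha | rfl
        · exact h1 a ha
        · exact hzb
      · rw [← mul_assoc]
        exact initialAlph_mul_mlet hθ h3 ⟨b, by simp, hbc⟩
    · exact Or.inl ⟨w, hw, b, hb.mem, h1, hzb, h2, h3⟩

/-- The two factorizations are `z' · zwc` and `zw · z'c`. -/
theorem separated_of_isPCCode (hθ : IsIndependence θ) (h : IsPCCode (beta θ B Z)) :
    Separated θ B Z := by
  intro z hz z' hz' hzz b hb
  by_contra hzb
  obtain ⟨w, hw, c, hc, hwz, hcz, h1, h2⟩ := hb.exists_trace hθ hzb
  have hc' : mlet θ c ∈ subTraces θ B := Submonoid.subset_closure ⟨c, hc, rfl⟩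
  let x₁ : beta θ B Z := ⟨mlet θ z', z', hz', 1, one_mem _, (mul_one _).symm,
    initialAlph_mlet hθ z'⟩
  let x₂ : beta θ B Z := ⟨mlet θ z * (w * mlet θ c), z, hz, _, mul_mem hw hc', rfl, h2⟩
  let x₃ : beta θ B Z := ⟨mlet θ z * w, z, hz, _, hw, rfl, h1⟩
  let x₄ : beta θ B Z := ⟨mlet θ z' * mlet θ c, z', hz', _, hc', rfl,
    initialAlph_mul_mlet hθ (initialAlph_mlet hθ z') ⟨z', by simp, hcz⟩⟩
  have hcomm : Commute (mlet θ z') (mlet θ z * w) := by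
    refine commute_of_alph fun a ha b hb => ?_
    rw [alph_mlet, Set.mem_singleton_iff] at ha
    subst ha
    rw [alph_mul, alph_mlet] at hb
    rcases hb with rfl | hb
    · exact hθ.symm _ _ hzz
    · exact hwz b hb
  have heq := h (FreeMonoid.of x₁ * FreeMonoid.of x₂) (FreeMonoid.of x₃ * FreeMonoid.of x₄) (by
    rw [map_mul, map_mul, FreeMonoid.lift_eval_of, FreeMonoid.lift_eval_of,
      FreeMonoid.lift_eval_of, FreeMonoid.lift_eval_of]
    calc mlet θ z' * (mlet θ z * (w * mlet θ c)) = mlet θ z' * (mlet θ z * w) * mlet θ c := by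
          simp only [mul_assoc]
      _ = mlet θ z * w * (mlet θ z' * mlet θ c) := by rw [hcomm.eq, mul_assoc])
  have heq' : mlet (traceRel (beta θ B Z)) x₁ * mlet _ x₂ = mlet _ x₃ * mlet _ x₄ := heq
  -- Equal elements over the code use the same code words, but `z'` differs from `zw` in its initial
  -- letter and from `z'c` in length.
  have hmem : x₁ ∈ alph (mlet (traceRel (beta θ B Z)) x₃ * mlet _ x₄) := by
    rw [← heq']; simp
  rw [alph_mul, alph_mlet, alph_mlet] at hmem
  rcases hmem with hmem | hmem
  · have : initialAlph x₁.1 = initialAlph x₃.1 := by rw [Set.mem_singleton_iff.1 hmem]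
    rw [show initialAlph x₁.1 = {z'} from initialAlph_mlet hθ z',
      show initialAlph x₃.1 = {z} from h1, Set.singleton_eq_singleton_iff] at this
    subst this
    exact hθ.irrefl _ hzz
  · have : length x₁.1 = length x₄.1 := by rw [Set.mem_singleton_iff.1 hmem]
    simp [x₁, x₄] at this

theorem isTFSA_iff_separated (hθ : IsIndependence θ) (hBZ : IsCompl B Z) :
    IsTFSA θ B ↔ Separated θ B Z := by
  rw [IsTFSA, hBZ.compl_eq]
  exact ⟨separated_of_isPCCode hθ, fun h => h.isPCCode hθ hBZ.disjoint⟩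

end Codes

end PartComm

namespace PartComm

/-! ### The natural map and its injectivity. -/

section NaturalMap

variable {A : Type*} {θ : A → A → Prop} {B Z : Set A}

theorem Reach.of_ext {z x : A ⊕ A} (h : Reach (extRel θ) (extSet B) z x) :
    Reach θ B (base z) (base x) := by
  induction h with
  | start hb h => exact Reach.start hb h
  | step _ hc h ih => exact ih.step hc h

theorem Separated.ext (hsep : Separated θ B Z) :
    Separated (extRel θ) (extSet B) (Sum.inl '' Z) := by
  rintro _ ⟨z, hz, rfl⟩ _ ⟨z', hz', rfl⟩ h x hx
  exact hsep z hz z' hz' h _ hx.of_ext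

theorem mlet_inl_mul_inj (hθ : IsIndependence θ) {z z' : A} {w w' : FPCMonoid (extRel θ)}
    (hm : mlet _ (Sum.inl z) * w ∈ betaR θ B Z)
    (h : mlet (extRel θ) (Sum.inl z) * w = mlet _ (Sum.inl z') * w') : z = z' ∧ w = w' := by
  obtain ⟨⟨y, _, v, _, _, hIA⟩, _⟩ := hm
  have h1 : Sum.inl z ∈ initialAlph (mlet (extRel θ) (Sum.inl z) * w) := ⟨w, rfl⟩
  have h2 : Sum.inl z' ∈ initialAlph (mlet (extRel θ) (Sum.inl z) * w) := ⟨w', h⟩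
  rw [hIA, Set.mem_singleton_iff] at h1 h2
  obtain rfl : z = z' := Sum.inl_injective (h1.trans h2.symm)
  exact ⟨rfl, mlet_mul_cancel hθ.ext h⟩

theorem exists_betaVert (x : betaR θ B Z) :
    ∃ (v : Vert θ B Z) (z : A) (hz : z ∈ Z) (w : FPCMonoid (extRel θ))
      (g : FPCGroup (restrictRel θ B)), x.1 = mlet _ (Sum.inl z) * w ∧
        w ∈ subTraces (extRel θ) (extSet B) ∧ subgroupMap θ B g = sMap θ w ∧
        v = ⟨⟨z, hz⟩, (g⁻¹ : FPCGroup (restrictRel θ B))⟩ := by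
  obtain ⟨⟨_, ⟨z, hz, rfl⟩, w, hw, hx, _⟩, _⟩ := x.2
  obtain ⟨g, hg⟩ := sMap_mem_range hw
  exact ⟨_, z, hz, w, g, hx, hw, hg, rfl⟩

/-- The pair of `z` and the coset of `w` that belongs to the trace `zw`. -/
noncomputable def betaVert (x : betaR θ B Z) : Vert θ B Z := (exists_betaVert x).choose

/-- The data in `betaVert` are chosen, but `z` is the only initial letter and left cancellation then
fixes `w`, so any factorization of `x` computes it. -/
theorem betaVert_spec (hθ : IsIndependence θ) (x : betaR θ B Z) {z : A}
    {w : FPCMonoid (extRel θ)} (h : x.1 = mlet _ (Sum.inl z) * w) :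
    ∃ (hz : z ∈ Z) (g : FPCGroup (restrictRel θ B)), w ∈ subTraces (extRel θ) (extSet B) ∧
      subgroupMap θ B g = sMap θ w ∧
      betaVert x = ⟨⟨z, hz⟩, (g⁻¹ : FPCGroup (restrictRel θ B))⟩ := by
  obtain ⟨z', hz', w', g, hx, hw', hg, hv⟩ := (exists_betaVert x).choose_spec
  obtain ⟨rfl, rfl⟩ := mlet_inl_mul_inj (B := B) (Z := Z) hθ (h ▸ x.2) (h.symm.trans hx)
  exact ⟨hz', g, hw', hg, hv⟩

theorem vertConj_betaVert (hθ : IsIndependence θ) (x : betaR θ B Z) {z : A}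
    {w : FPCMonoid (extRel θ)} (h : x.1 = mlet _ (Sum.inl z) * w) :
    vertConj (betaVert x) = (sMap θ w)⁻¹ * glet θ z * sMap θ w := by
  obtain ⟨hz, g, _, hg, hv⟩ := betaVert_spec hθ x h
  rw [hv, vertConj_inv_mk ⟨z, hz⟩ hg]

theorem exists_eq_mlet_mul (x : betaR θ B Z) :
    ∃ z ∈ Z, ∃ w ∈ subTraces (extRel θ) (extSet B), x.1 = mlet _ (Sum.inl z) * w ∧
      initialAlph (mlet (extRel θ) (Sum.inl z) * w) = {Sum.inl z} := by
  obtain ⟨⟨_, ⟨z, hz, rfl⟩, w, hw, hx, hIA⟩, _⟩ := x.2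
  exact ⟨z, hz, w, hw, hx, hx ▸ hIA⟩

/-- Equal cosets mean that `s(w)` and `s(w')` differ on the left by an element of the star of `z`;
minimal traces of such a coset are unique. -/
theorem betaVert_injective (hθ : IsIndependence θ) :
    Function.Injective (betaVert (θ := θ) (B := B) (Z := Z)) := by
  intro x x' h
  obtain ⟨z, hz, w, hw, hx, _⟩ := exists_eq_mlet_mul x
  obtain ⟨z', hz', w', hw', hx', _⟩ := exists_eq_mlet_mul x'
  obtain ⟨_, g, _, hg, hv⟩ := betaVert_spec hθ x hx
  obtain ⟨_, g', _, hg', hv'⟩ := betaVert_spec hθ x' hx'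
  rw [hv, hv', Sigma.mk.injEq, Subtype.mk.injEq] at h
  obtain ⟨rfl, h⟩ := h
  have h := QuotientGroup.eq.1 (eq_of_heq h)
  rw [inv_inv] at h
  have hstar : subgroupMap θ B (g * g'⁻¹) ∈ Subgroup.closure (glet θ '' {a | θ z a}) := by
    have : (starSubgroup θ B z).map (subgroupMap θ B) ≤
        Subgroup.closure (glet θ '' {a | θ z a}) := by
      rw [starSubgroup, MonoidHom.map_closure, Subgroup.closure_le]
      rintro _ ⟨_, ⟨b, hb, rfl⟩, rfl⟩
      rw [subgroupMap_glet]
      exact Subgroup.subset_closure ⟨b, hb, rfl⟩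
    exact this ⟨_, h, rfl⟩
  apply Subtype.ext
  rw [hx, hx', eq_of_mem_betaR (B := B) (Z := Z) (w := w') (w' := w) hθ (hx' ▸ x'.2) (hx ▸ x.2)
    hstar (by rw [map_mul, map_inv, hg, hg', inv_mul_cancel_right])]

theorem isIndependence_betaR (hθ : IsIndependence θ) :
    IsIndependence (traceRel (betaR θ B Z)) :=
  isIndependence_traceRel hθ.ext fun _ hx => alph_nonempty_of_mem_beta hx.1

theorem vertConj_betaVert_comm (hθ : IsIndependence θ) (x x' : betaR θ B Z)
    (h : traceRel (betaR θ B Z) x x') :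
    vertConj (betaVert x) * vertConj (betaVert x') =
      vertConj (betaVert x') * vertConj (betaVert x) := by
  obtain ⟨z, hz, w, hw, hx, _⟩ := exists_eq_mlet_mul x
  obtain ⟨z', hz', w', hw', hx', _⟩ := exists_eq_mlet_mul x'
  rw [vertConj_betaVert hθ x hx, vertConj_betaVert hθ x' hx']
  rw [traceRel, hx, hx'] at h
  have key : ∀ {s t : FPCMonoid (extRel θ)}, (alph s ⊆ alph (mlet (extRel θ) (Sum.inl z) * w)) →
      (alph t ⊆ alph (mlet (extRel θ) (Sum.inl z') * w')) → Commute (sMap θ s) (sMap θ t) :=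
    fun hs ht => (commute_of_alph fun a ha b hb => h a (hs ha) b (ht hb)).map (sMap θ)
  have h1 : alph w ⊆ alph (mlet (extRel θ) (Sum.inl z) * w) := by simp
  have h2 : alph w' ⊆ alph (mlet (extRel θ) (Sum.inl z') * w') := by simp
  have h3 : alph (mlet (extRel θ) (Sum.inl z)) ⊆ alph (mlet (extRel θ) (Sum.inl z) * w) := by simp
  have h4 : alph (mlet (extRel θ) (Sum.inl z')) ⊆ alph (mlet (extRel θ) (Sum.inl z') * w') := by
    simp
  have hz : sMap θ (mlet (extRel θ) (Sum.inl z)) = glet θ z := sMap_mlet _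
  have hz' : sMap θ (mlet (extRel θ) (Sum.inl z')) = glet θ z' := sMap_mlet _
  rw [← hz, ← hz']
  have c1 := (((key h1 h2).inv_right.mul_right (key h1 h4)).mul_right (key h1 h2))
  have c2 := (((key h3 h2).inv_right.mul_right (key h3 h4)).mul_right (key h3 h2))
  exact ((c1.inv_left.mul_left c2).mul_left c1).eq

/-- The natural map `α`. -/
noncomputable def naturalMap (hθ : IsIndependence θ) (B Z : Set A) :
    FPCGroup (traceRel (betaR θ B Z)) →* HZ θ Z :=
  glift (fun x => ⟨vertConj (betaVert x), vertConj_mem_HZ _⟩)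
    fun x x' h => Subtype.ext (vertConj_betaVert_comm hθ x x' h)

theorem naturalMap_glet (hθ : IsIndependence θ) (x : betaR θ B Z) :
    (naturalMap hθ B Z (glet _ x) : FPCGroup θ) = vertConj (betaVert x) := by
  rw [naturalMap, glift_glet]

theorem isNatural_naturalMap (hθ : IsIndependence θ) : IsNatural θ B Z (naturalMap hθ B Z) := by
  intro x z _ w _ h
  rw [naturalMap_glet, vertConj_betaVert hθ x h]

theorem IsNatural.eq_naturalMap (hθ : IsIndependence θ)
    {α : FPCGroup (traceRel (betaR θ B Z)) →* HZ θ Z} (hα : IsNatural θ B Z α) :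
    α = naturalMap hθ B Z := by
  apply fpcGroup_hom_ext
  intro x
  obtain ⟨z, hz, w, hw, hx, _⟩ := exists_eq_mlet_mul x
  apply Subtype.ext
  rw [hα x z hz w hw hx, isNatural_naturalMap hθ x z hz w hw hx]

/-- Under separation `betaVert` preserves and reflects the relations, so `α` followed by the
inclusion is an injective map of generators followed by the embedding `vertHom`. -/
theorem naturalMap_injective (hθ : IsIndependence θ) (hBZ : IsCompl B Z)
    (hsep : Separated θ B Z) : Function.Injective (naturalMap hθ B Z) := by
  have hrel : ∀ x x' : betaR θ B Z, traceRel (betaR θ B Z) x x' ↔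
      vertRel θ B Z (betaVert x) (betaVert x') := by
    intro x x'
    constructor
    · intro h
      rw [vertRel_iff hθ hBZ]
      refine ⟨vertConj_betaVert_comm hθ x x' h, fun h' => ?_⟩
      have := betaVert_injective hθ (vertConj_injective hθ hBZ h')
      subst this
      exact (isIndependence_betaR hθ).irrefl _ h
    · rintro ⟨h, _⟩
      obtain ⟨z, hz, w, hw, hx, hIA⟩ := exists_eq_mlet_mul x
      obtain ⟨z', hz', w', hw', hx', hIA'⟩ := exists_eq_mlet_mul x'
      obtain ⟨_, g, _, hg, hv⟩ := betaVert_spec hθ x hx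
      obtain ⟨_, g', _, hg', hv'⟩ := betaVert_spec hθ x' hx'
      rw [hv, hv'] at h
      rw [traceRel, hx, hx']
      exact hsep.ext.forall_rel hθ.ext ⟨z, hz, rfl⟩ ⟨z', hz', rfl⟩ h hw hw' hIA hIA'
  have hcomp : (HZ θ Z).subtype.comp (naturalMap hθ B Z) =
      (vertHom θ B Z).comp (gmap betaVert fun x x' => (hrel x x').1) := by
    apply fpcGroup_hom_ext
    intro x
    rw [MonoidHom.comp_apply, MonoidHom.comp_apply, gmap_glet, vertHom_glet]
    exact naturalMap_glet hθ x
  have hinj : Function.Injective ((HZ θ Z).subtype.comp (naturalMap hθ B Z)) := by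
    rw [hcomp, MonoidHom.coe_comp]
    exact (vertHom_injective hθ hBZ).comp (gmap_injective _ (betaVert_injective hθ) hrel)
  rw [MonoidHom.coe_comp] at hinj
  exact hinj.of_comp

theorem degree_sMap_le (t : FPCMonoid (extRel θ)) :
    (degree θ (sMap θ t)).toAdd ≤ (length t : ℤ) := by
  induction t using trace_induction with
  | one => simp
  | mul x t ih =>
    rw [map_mul, map_mul, sMap_mlet, toAdd_mul, length_mul, length_mlet, Nat.cast_add, Nat.cast_one]
    refine add_le_add ?_ ih
    rcases x with a | a
    · rw [sZero, degree_glet, toAdd_ofAdd]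
    · rw [sZero, map_inv, degree_glet, toAdd_inv, toAdd_ofAdd]
      norm_num

theorem degree_sMap_of_positive {t : FPCMonoid (extRel θ)} (ht : alph t ⊆ Set.range Sum.inl) :
    (degree θ (sMap θ t)).toAdd = (length t : ℤ) := by
  induction t using trace_induction with
  | one => simp
  | mul x t ih =>
    rw [alph_mul, alph_mlet, Set.union_subset_iff, Set.singleton_subset_iff] at ht
    obtain ⟨⟨a, rfl⟩, ht⟩ := ht
    rw [map_mul, map_mul, sMap_mlet, toAdd_mul, length_mul, length_mlet, Nat.cast_add, Nat.cast_one,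
      ih ht, sZero, degree_glet, toAdd_ofAdd]

/-- The exponent sum is at most the length, with equality for traces without barred letters. Hence
unbarred witnesses are automatically reduced. -/
theorem mem_reduced_of_positive {t : FPCMonoid (extRel θ)} (ht : alph t ⊆ Set.range Sum.inl) :
    t ∈ reduced θ := by
  intro t' h
  have := degree_sMap_le t'
  rw [h, degree_sMap_of_positive ht] at this
  exact_mod_cast this

theorem Reach.inl {z b : A} (h : Reach θ B z b) :
    Reach (extRel θ) (Sum.inl '' B) (Sum.inl z) (Sum.inl b) := by
  induction h with
  | start hb h => exact Reach.start ⟨_, hb, rfl⟩ h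
  | step _ hc h ih => exact ih.step ⟨_, hc, rfl⟩ h

theorem mem_betaR_of_positive {z : A} (hz : z ∈ Z) {w : FPCMonoid (extRel θ)}
    (hw : w ∈ subTraces (extRel θ) (Sum.inl '' B))
    (h : initialAlph (mlet (extRel θ) (Sum.inl z) * w) = {Sum.inl z}) :
    mlet _ (Sum.inl z) * w ∈ betaR θ B Z := by
  rw [mem_subTraces_iff] at hw
  refine ⟨⟨_, ⟨z, hz, rfl⟩, w, mem_subTraces_iff.2 fun x hx => ?_, rfl, h⟩,
    mem_reduced_of_positive ?_⟩
  · obtain ⟨b, hb, rfl⟩ := hw hx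
    exact hb
  · rw [alph_mul, alph_mlet, Set.union_subset_iff, Set.singleton_subset_iff]
    exact ⟨⟨z, rfl⟩, hw.trans (Set.image_subset_range _ _)⟩

theorem separated_of_injective (hθ : IsIndependence θ)
    (hinj : Function.Injective (naturalMap hθ B Z)) : Separated θ B Z := by
  intro z hz z' hz' hzz b hb
  by_contra hzb
  -- The path is taken in the unbarred letters, so that `zwc` and `z'c` are positive.
  obtain ⟨w, hw, _, ⟨c, hc, rfl⟩, hwz, hcz, -, h2⟩ :=
    hb.inl.exists_trace (z' := Sum.inl z') hθ.ext hzb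
  have hc' : mlet (extRel θ) (Sum.inl c) ∈ subTraces (extRel θ) (Sum.inl '' B) :=
    Submonoid.subset_closure ⟨_, ⟨c, hc, rfl⟩, rfl⟩
  have hIA' : initialAlph (mlet (extRel θ) (Sum.inl z') * mlet _ (Sum.inl c)) = {Sum.inl z'} :=
    initialAlph_mul_mlet hθ.ext (initialAlph_mlet hθ.ext _) ⟨Sum.inl z', by simp, hcz⟩
  let x : betaR θ B Z := ⟨_, mem_betaR_of_positive hz (mul_mem hw hc') h2⟩
  let y : betaR θ B Z := ⟨_, mem_betaR_of_positive hz' hc' hIA'⟩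
  have hxy : x ≠ y := by
    intro h
    have : initialAlph x.1 = initialAlph y.1 := by rw [h]
    rw [show initialAlph x.1 = _ from h2, show initialAlph y.1 = _ from hIA',
      Set.singleton_eq_singleton_iff] at this
    have hz := Sum.inl_injective this
    subst hz
    exact hθ.irrefl _ hzz
  have hcw : Commute (glet θ z') (sMap θ w) := by
    have := (commute_of_alph (s := mlet (extRel θ) (Sum.inl z')) (t := w) fun a ha b hb => by
      rw [alph_mlet, Set.mem_singleton_iff] at ha
      subst ha
      exact hwz b hb).map (sMap θ)
    rwa [sMap_mlet] at this
  have hα : Commute (naturalMap hθ B Z (glet _ x)) (naturalMap hθ B Z (glet _ y)) := by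
    apply Subtype.ext
    rw [Subgroup.coe_mul, Subgroup.coe_mul, naturalMap_glet, naturalMap_glet,
      vertConj_betaVert hθ x rfl, vertConj_betaVert hθ y rfl]
    -- Since `z'` commutes with `w`, conjugating it by `c` or by `wc` gives the same element. Both
    -- images are then conjugates of commuting letters by `wc`.
    have hy : (sMap θ (mlet _ (Sum.inl c)))⁻¹ * glet θ z' * sMap θ (mlet _ (Sum.inl c)) =
        (sMap θ (w * mlet _ (Sum.inl c)))⁻¹ * glet θ z' * sMap θ (w * mlet _ (Sum.inl c)) := by
      rw [map_mul, mul_inv_rev]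
      calc _ = (sMap θ (mlet _ (Sum.inl c)))⁻¹ *
            ((sMap θ w)⁻¹ * (sMap θ w * glet θ z')) * sMap θ (mlet _ (Sum.inl c)) := by group
        _ = _ := by rw [← hcw.eq]; group
    rw [hy]
    calc _ = (sMap θ (w * mlet _ (Sum.inl c)))⁻¹ * (glet θ z * glet θ z') *
          sMap θ (w * mlet _ (Sum.inl c)) := by group
      _ = _ := by rw [glet_comm hzz]; group
  have hG : Commute (glet (traceRel (betaR θ B Z)) x) (glet _ y) :=
    hinj (by rw [map_mul, map_mul, hα.eq])
  have hrel := rel_of_commute (isIndependence_betaR hθ) hxy hG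
  exact hcz (hθ.symm _ _ (hrel (Sum.inl c) (by simp [x]) (Sum.inl z') (by simp [y])))

end NaturalMap

/-! ### The presentation of `H_Z` on `ρ_Z(B)`. -/

section Structure

variable {A : Type*} {θ : A → A → Prop} {B Z : Set A}

/-- `ρ_Z(B)` as the set of generators `Vert`. -/
noncomputable def rhoEquiv (hθ : IsIndependence θ) (hBZ : IsCompl B Z) :
    rho θ B Z ≃ Vert θ B Z :=
  (Equiv.setCongr (rho_eq_range hθ hBZ)).trans
    (Equiv.ofInjective _ (vertConj_injective hθ hBZ)).symm

theorem vertConj_rhoEquiv (hθ : IsIndependence θ) (hBZ : IsCompl B Z) (t : rho θ B Z) :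
    vertConj (rhoEquiv hθ hBZ t) = t :=
  Equiv.apply_ofInjective_symm (vertConj_injective hθ hBZ) _

theorem rhoRel_iff (hθ : IsIndependence θ) (hBZ : IsCompl B Z) (t t' : rho θ B Z) :
    rhoRel θ B Z t t' ↔ vertRel θ B Z (rhoEquiv hθ hBZ t) (rhoEquiv hθ hBZ t') := by
  rw [vertRel_iff hθ hBZ, vertConj_rhoEquiv, vertConj_rhoEquiv, rhoRel, ne_eq, ne_eq,
    Subtype.ext_iff]

/-- The isomorphism from the free partially commutative group on `ρ_Z(B)` to `H_Z`. -/
noncomputable def rhoIso (hθ : IsIndependence θ) (hBZ : IsCompl B Z) :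
    FPCGroup (rhoRel θ B Z) ≃* HZ θ Z :=
  (gequiv (rhoEquiv hθ hBZ) (rhoRel_iff hθ hBZ)).trans
    (((vertHom θ B Z).ofInjective (vertHom_injective hθ hBZ)).trans
      (MulEquiv.subgroupCongr (HZ_eq_ker hθ hBZ).2.symm))

theorem rhoIso_glet (hθ : IsIndependence θ) (hBZ : IsCompl B Z) (t : rho θ B Z) :
    (rhoIso hθ hBZ (glet _ t) : FPCGroup θ) = t := by
  change vertHom θ B Z (gequiv (rhoEquiv hθ hBZ) (rhoRel_iff hθ hBZ) (glet _ t)) = t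
  rw [gequiv_glet, vertHom_glet, vertConj_rhoEquiv]

end Structure

end PartComm

theorem mainTheorem6 {A : Type*} (θ : A → A → Prop)
    (hirr : ∀ a, ¬ θ a a) (hsymm : ∀ a b, θ a b → θ b a)
    (B Z : Set A) (hBZ : IsCompl B Z) :
    -- (i) `F(A,θ) = F(B,θ_B) ⋉ H_Z`, and `H_Z` is generated by `ρ_Z(B)`
    (Function.Injective (PartComm.subgroupMap θ B) ∧
      (PartComm.HZ θ Z).Normal ∧
      Subgroup.IsComplement' (PartComm.subgroupMap θ B).range (PartComm.HZ θ Z) ∧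
      PartComm.HZ θ Z = Subgroup.closure (PartComm.rho θ B Z)) ∧
    -- (ii) `H_Z` is free partially commutative on `ρ_Z(B)` with the commutations `θ̂_ρ`
    (∃ e : PartComm.FPCGroup (PartComm.rhoRel θ B Z) ≃* PartComm.HZ θ Z,
      ∀ t : PartComm.rho θ B Z,
        (e (PartComm.glet (PartComm.rhoRel θ B Z) t) : PartComm.FPCGroup θ) = t) ∧
    -- (iii) the natural map `α` exists, is unique, and is injective iff `B` is a TFSA
    ((∃! α : PartComm.FPCGroup (PartComm.traceRel (PartComm.betaR θ B Z)) →* PartComm.HZ θ Z,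
        PartComm.IsNatural θ B Z α) ∧
      ∀ α : PartComm.FPCGroup (PartComm.traceRel (PartComm.betaR θ B Z)) →* PartComm.HZ θ Z,
        PartComm.IsNatural θ B Z α →
          (Function.Injective α ↔ PartComm.IsTFSA θ B)) := by
  have hθ : PartComm.IsIndependence θ := ⟨hirr, hsymm⟩
  refine ⟨⟨PartComm.subgroupMap_injective hθ hBZ, Subgroup.normalClosure_normal,
    PartComm.isComplement'_HZ hθ hBZ, ?_⟩,
    ⟨PartComm.rhoIso hθ hBZ, PartComm.rhoIso_glet hθ hBZ⟩,
    ⟨PartComm.naturalMap hθ B Z, PartComm.isNatural_naturalMap hθ, fun α hα =>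
      PartComm.IsNatural.eq_naturalMap hθ hα⟩, fun α hα => ?_⟩
  · rw [(PartComm.HZ_eq_ker hθ hBZ).2, PartComm.range_vertHom, PartComm.rho_eq_range hθ hBZ]
  · rw [PartComm.IsNatural.eq_naturalMap hθ hα, PartComm.isTFSA_iff_separated hθ hBZ]
    exact ⟨PartComm.separated_of_injective hθ, PartComm.naturalMap_injective hθ hBZ⟩
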